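/- **Conventions.** All structures are finite and relational, with nonempty universe and finite vocabulary. For a class $\mathcal K$ of structures over a vocabulary $\{R_1,\dots,R_m\}$ that is closed under isomorphism, the generalized quantifier $Q_{\mathcal K}$ binds tuples $\bar y_1,\dots,\bar y_m$ of distinct variables, $|\bar y_i|=\mathrm{ar}(R_i)$, in formulas $\psi_1,\dots,\psi_m$; $(\mathbf A,\alpha)\models Q_{\mathcal K}\bar y_1,\dots,\bar y_m(\psi_1,\dots,\psi_m)$ iff the structure with universe $A$ and relations $\{\bar b \mid (\mathbf A,\alpha[\bar b/\bar y_i])\models\psi_i\}$ is in $\mathcal K$. Its arity is $\max_i \mathrm{ar}(R_i)$. $\mathcal Q_k$ is the collection of all quantifiers of arity at most $k$. The partial Maltsev operation on a set $A$ is the partial function $m\colon A^3\to A$ with $m(a,a,b)=m(b,a,a)=b$, and $m(a,b,c)$ undefined if $a\ne b$ and $b\ne c$; for $R\subseteq A^r$ let $m(R)$ be the set of results of applying $m$ componentwise to three tuples of $R$. $Q_{\mathcal K}$ is Maltsev-closed if $\mathbf A\in\mathcal K$ whenever $\mathbf B\in\mathcal K$, $A=B$ and $R^{\mathbf A}\subseteq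 R^{\mathbf B}\cup m(R^{\mathbf B})$ for every relation symbol $R$. $\mathcal Q_k^{\mathcal M}$ is the collection of all Maltsev-closed quantifiers in $\mathcal Q_k$. $\mathcal L^k(\mathcal Q)$ is the infinitary logic with $k$ variables (and equality), extended by the quantifiers in $\mathcal Q$. $L\le L'$ means that every sentence of $L$ is equivalent on all structures to a sentence of $L'$, and $L\lneq L'$ means $L\le L'$ and $L'\not\le L$. **The structures.** Let $G=(V,E)$ be a finite $k$-regular graph with at least one edge and with a linear order on $V$; order $E$ lexicographically, comparing first the smaller and then the larger endpoints. For $v\in V$ let $e_1<\dots<e_k$ be the edges at $v$ and, for $s\in\{0,1\}$, put $$R_0(v,s)=\Big\{((e_1,a_1),\dots,(e_k,a_k)) \;\Big|\; a_i\in\mathbb Z_4,\ \sum_i a_i-2s\in\{0,1\}\Big\},\qquad R_1(v,s)=\Big\{((e_1,a_1),\dots,(e_k,a_k)) \;\Big|\; a_i\in\mathbb Z_4,\ \sum_i a_i-2s\in\{2,3\}\Big\}.$$ $\mathbf A(G)$ has universe $E\times\mathbb Z_4$, the $k$-ary relations $R_j=\bigcup_{v\in V}R_j(v,0)$ for $j=0,1$,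 and the binary relation $(e,a)\prec(e',a')\iff e\le e'$. $\tilde{\mathbf A}(G)$ is defined in the same way, except that $R_j(\tilde v,1)$ replaces $R_j(\tilde v,0)$ for the smallest vertex $\tilde v$ of $G$. **The $k$-variable Maltsev game** on $\mathbf A,\mathbf B$. A position is a pair $(\alpha,\beta)$ of partial assignments of elements of $\mathbf A$, respectively $\mathbf B$, to variables $x_1,\dots,x_k$ with the same domain. If $\alpha\mapsto\beta$ is not a partial isomorphism, Spoiler wins. Otherwise Spoiler chooses a left or a right move, $r\in\{1,\dots,k\}$ and an $r$-tuple $\bar y$ of distinct variables. In a right move, Duplicator chooses a bijection $f\colon A\to B$, Spoiler chooses $\bar a\in A^r$, Duplicator chooses $P=\{\bar b_1,\bar b_2,\bar b_3\}\subseteq B^r$ with $f(\bar a)$ in the closure of $P$ under $m$, Spoiler chooses $\bar b\in P$, and the next position is $(\alpha[\bar a/\bar y],\beta[\bar b/\bar y])$. A left move is the same with the roles of $\mathbf A$ and $\mathbf B$ exchanged. Duplicator wins if Spoiler does not win after finitely many rounds. **Theorem.** For every $k\ge 3$, $$\mathcal L^k(\mathcal Q_k^{\mathcal M})\lneq\mathcal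 L^k(\mathcal Q_k).$$ Moreover, let $G$ be the graph obtained from the complete bipartite graph $K_{k+1,k+1}$ by removing a perfect matching, with any linear order on its vertices. Then $\mathbf A(G)$ and $\tilde{\mathbf A}(G)$ are not isomorphic; some sentence of $\mathcal L^k(\mathcal Q_k)$ is true in $\mathbf A(G)$ and false in $\tilde{\mathbf A}(G)$; $\mathbf A(G)$ and $\tilde{\mathbf A}(G)$ satisfy the same sentences of $\mathcal L^k(\mathcal Q_k^{\mathcal M})$; and Duplicator has a winning strategy in the $k$-variable Maltsev game on $\mathbf A(G)$ and $\tilde{\mathbf A}(G)$ from the empty position. -/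

import Mathlib

/-! Finite relational vocabularies and structures -/

/-- A finite relational vocabulary `{R_0, …, R_{m-1}}` with the arities of its symbols. -/
structure Vocabulary where
  m : ℕ
  ar : Fin m → ℕ

/-- A finite relational structure over `σ` (with nonempty universe). -/
structure FinStr (σ : Vocabulary) where
  carrier : Type
  finite : Finite carrier
  nonempty : Nonempty carrier
  rel : ∀ i : Fin σ.m, Set (Fin (σ.ar i) → carrier)

/-- The structure with the same universe as `A` and with the relations `R`
(possibly over another vocabulary). -/
def FinStr.withRel {σ τ : Vocabulary} (A : FinStr σ)
    (R : ∀ i : Fin τ.m, Set (Fin (τ.ar i) → A.carrier)) : FinStr τ where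
  carrier := A.carrier
  finite := A.finite
  nonempty := A.nonempty
  rel := R

/-- `A` and `B` are isomorphic. -/
def FinStr.Isomorphic {σ : Vocabulary} (A B : FinStr σ) : Prop :=
  ∃ f : A.carrier ≃ B.carrier,
    ∀ (i : Fin σ.m) (t : Fin (σ.ar i) → A.carrier), t ∈ A.rel i ↔ (fun j => f (t j)) ∈ B.rel i

/-! Generalized quantifiers -/

/-- A generalized (Lindström) quantifier `Q_K`: an isomorphism-closed class `K` of finite
structures over a finite relational vocabulary. -/
structure Quantifier where
  voc : Vocabulary
  cls : Set (FinStr voc)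
  iso_closed : ∀ A B : FinStr voc, A.Isomorphic B → A ∈ cls → B ∈ cls

/-- The collection of all quantifiers of arity at most `r`. -/
def quantifiersOfArity (r : ℕ) : Set Quantifier :=
  {Q | ∀ i : Fin Q.voc.m, Q.voc.ar i ≤ r}

/-- The graph of the partial Maltsev operation: `IsMaltsev a b c d` says that `m(a, b, c)` is
defined and equal to `d`. Thus `m(a, a, c) = c` and `m(a, b, b) = a`, and `m(a, b, c)` is
undefined if `a ≠ b` and `b ≠ c`. -/
def IsMaltsev {A : Type} (a b c d : A) : Prop :=
  (a = b ∧ d = c) ∨ (b = c ∧ d = a)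

theorem IsMaltsev.unique {A : Type} {a b c d d' : A}
    (h : IsMaltsev a b c d) (h' : IsMaltsev a b c d') : d = d' := by
  unfold IsMaltsev at h h'
  grind

/-- `m(R)`: all results of applying the partial Maltsev operation columnwise to three tuples
of `R`. -/
def maltsevImage {A : Type} {r : ℕ} (R : Set (Fin r → A)) : Set (Fin r → A) :=
  {d | ∃ a ∈ R, ∃ b ∈ R, ∃ c ∈ R, ∀ j, IsMaltsev (a j) (b j) (c j) (d j)}

/-- `Q_K` is closed under the partial Maltsev operation: `B ∈ K` and `A ≤ B ∪ m(B)` imply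
`A ∈ K`. -/
def Quantifier.MaltsevClosed (Q : Quantifier) : Prop :=
  ∀ B ∈ Q.cls, ∀ R : ∀ i : Fin Q.voc.m, Set (Fin (Q.voc.ar i) → B.carrier),
    (∀ i, R i ⊆ B.rel i ∪ maltsevImage (B.rel i)) → B.withRel R ∈ Q.cls

/-- The collection of all Maltsev-closed quantifiers of arity at most `r`. -/
def maltsevQuantifiersOfArity (r : ℕ) : Set Quantifier :=
  {Q | Q.MaltsevClosed} ∩ quantifiersOfArity r

/-! Infinitary `k`-variable logic with generalized quantifiers -/

/-- Formulas over `σ` of the infinitary `k`-variable logic extended by the quantifiers in `𝒬`.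
The variables are the elements of `Fin k`; disjunction and `∀` are expressed with negation. -/
inductive Formula (σ : Vocabulary) (k : ℕ) (𝒬 : Set Quantifier) : Type 1
  | eq (x y : Fin k) : Formula σ k 𝒬
  | rel (i : Fin σ.m) (x : Fin (σ.ar i) → Fin k) : Formula σ k 𝒬
  | neg (φ : Formula σ k 𝒬) : Formula σ k 𝒬
  | conj {ι : Type} (φ : ι → Formula σ k 𝒬) : Formula σ k 𝒬
  | ex (x : Fin k) (φ : Formula σ k 𝒬) : Formula σ k 𝒬
  | quant (Q : Quantifier) (hQ : Q ∈ 𝒬) (y : ∀ i : Fin Q.voc.m, Fin (Q.voc.ar i) ↪ Fin k)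
      (ψ : Fin Q.voc.m → Formula σ k 𝒬) : Formula σ k 𝒬

namespace Formula

variable {σ : Vocabulary} {k : ℕ} {𝒬 : Set Quantifier}

/-- The free variables of a formula. -/
def freeVars : Formula σ k 𝒬 → Set (Fin k)
  | eq x y => {x, y}
  | rel _ x => Set.range x
  | neg φ => φ.freeVars
  | conj φ => ⋃ i, (φ i).freeVars
  | ex x φ => φ.freeVars \ {x}
  | quant _ _ y ψ => ⋃ i, (ψ i).freeVars \ Set.range (y i)

/-- Satisfaction. Here `Function.extend y b α` is the assignment `α[b/y]`. -/
def Sat (A : FinStr σ) : Formula σ k 𝒬 → (Fin k → A.carrier) → Prop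
  | eq x y, α => α x = α y
  | rel i x, α => (fun j => α (x j)) ∈ A.rel i
  | neg φ, α => ¬ φ.Sat A α
  | conj φ, α => ∀ i, (φ i).Sat A α
  | ex x φ, α => ∃ a : A.carrier, φ.Sat A (Function.update α x a)
  | quant Q _ y ψ, α =>
      A.withRel (fun i => {b | (ψ i).Sat A (Function.extend (y i) b α)}) ∈ Q.cls

end Formula

/-- Sentences: formulas without free variables. -/
def Sentence (σ : Vocabulary) (k : ℕ) (𝒬 : Set Quantifier) : Type 1 :=
  {φ : Formula σ k 𝒬 // φ.freeVars = ∅}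

/-- Truth of a sentence in a structure (its truth value does not depend on the assignment). -/
def FinStr.Models {σ : Vocabulary} {k : ℕ} {𝒬 : Set Quantifier} (A : FinStr σ)
    (φ : Sentence σ k 𝒬) : Prop :=
  ∀ α : Fin k → A.carrier, φ.1.Sat A α

/-- `L^k(𝒬) ≤ L^k(𝒬')`: every sentence of the first logic is equivalent, on all finite
structures, to a sentence of the second. -/
def LogicLE (k : ℕ) (𝒬 𝒬' : Set Quantifier) : Prop :=
  ∀ (σ : Vocabulary) (φ : Sentence σ k 𝒬), ∃ φ' : Sentence σ k 𝒬',
    ∀ A : FinStr σ, A.Models φ ↔ A.Models φ'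

/-- `L^k(𝒬)` is strictly weaker than `L^k(𝒬')`. -/
def LogicLT (k : ℕ) (𝒬 𝒬' : Set Quantifier) : Prop :=
  LogicLE k 𝒬 𝒬' ∧ ¬ LogicLE k 𝒬' 𝒬

/-! The pebble game for Maltsev-closed quantifiers -/

/-- The closure of a set of tuples under the partial Maltsev operation. -/
inductive MaltsevClosure {A : Type} {r : ℕ} (P : Set (Fin r → A)) : Set (Fin r → A)
  | base {a : Fin r → A} (ha : a ∈ P) : MaltsevClosure P a
  | step {a b c d : Fin r → A} (ha : MaltsevClosure P a) (hb : MaltsevClosure P b)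
      (hc : MaltsevClosure P c) (h : ∀ j, IsMaltsev (a j) (b j) (c j) (d j)) : MaltsevClosure P d

/-- Partial assignments of elements of `A` to the `k` variables. -/
abbrev PartialAssignment (k : ℕ) {σ : Vocabulary} (A : FinStr σ) : Type :=
  Fin k → Option A.carrier

/-- `α ↦ β` is a partial isomorphism from `A` to `B`: the domains agree, and equalities and
relations between pebbled elements are preserved in both directions. -/
def IsPartialIso {k : ℕ} {σ : Vocabulary} (A B : FinStr σ)
    (α : PartialAssignment k A) (β : PartialAssignment k B) : Prop :=
  (∀ x, α x = none ↔ β x = none) ∧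
  (∀ x y, α x = α y ↔ β x = β y) ∧
  ∀ (i : Fin σ.m) (x : Fin (σ.ar i) → Fin k)
    (a : Fin (σ.ar i) → A.carrier) (b : Fin (σ.ar i) → B.carrier),
    (∀ j, α (x j) = some (a j)) → (∀ j, β (x j) = some (b j)) → (a ∈ A.rel i ↔ b ∈ B.rel i)

/-- The assignment `α[a/y]`. -/
noncomputable def PartialAssignment.subst {k : ℕ} {σ : Vocabulary} {A : FinStr σ} {r : ℕ}
    (α : PartialAssignment k A) (y : Fin r ↪ Fin k) (a : Fin r → A.carrier) :
    PartialAssignment k A :=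
  Function.extend y (fun j => some (a j)) α

/-- From the position `(α, β)`, whatever left quantifier move Spoiler makes, Duplicator can
answer so that the next position is in `W`. -/
def LeftMove {k : ℕ} {σ : Vocabulary} (A B : FinStr σ)
    (W : PartialAssignment k A → PartialAssignment k B → Prop)
    (α : PartialAssignment k A) (β : PartialAssignment k B) : Prop :=
  ∀ r : ℕ, 1 ≤ r → r ≤ k → ∀ y : Fin r ↪ Fin k,
    ∃ f : B.carrier ≃ A.carrier, ∀ b : Fin r → B.carrier,
      ∃ p : Fin 3 → Fin r → A.carrier,
        (fun j => f (b j)) ∈ MaltsevClosure (Set.range p) ∧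
        ∀ a ∈ Set.range p, W (α.subst y a) (β.subst y b)

/-- The same for right quantifier moves. -/
def RightMove {k : ℕ} {σ : Vocabulary} (A B : FinStr σ)
    (W : PartialAssignment k A → PartialAssignment k B → Prop)
    (α : PartialAssignment k A) (β : PartialAssignment k B) : Prop :=
  ∀ r : ℕ, 1 ≤ r → r ≤ k → ∀ y : Fin r ↪ Fin k,
    ∃ f : A.carrier ≃ B.carrier, ∀ a : Fin r → A.carrier,
      ∃ p : Fin 3 → Fin r → B.carrier,
        (fun j => f (a j)) ∈ MaltsevClosure (Set.range p) ∧
        ∀ b ∈ Set.range p, W (α.subst y a) (β.subst y b)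

/-- Duplicator has a winning strategy in the `k`-variable Maltsev game on `A` and `B` from the
position `(α, β)`: there is a set `W` of positions containing `(α, β)`, in none of which Spoiler
has won, such that Duplicator can always move from `W` to `W`. -/
def DuplicatorWins (k : ℕ) {σ : Vocabulary} (A B : FinStr σ)
    (α : PartialAssignment k A) (β : PartialAssignment k B) : Prop :=
  ∃ W : PartialAssignment k A → PartialAssignment k B → Prop, W α β ∧
    ∀ α' β', W α' β' → IsPartialIso A B α' β' ∧ LeftMove A B W α' β' ∧ RightMove A B W α' β'

/-! The CFI-like structures over `ZMod 4` -/

/-- Two symbols `R₀`, `R₁` of arity `k` and a binary symbol `≺`. -/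
abbrev cfiVocabulary (k : ℕ) : Vocabulary where
  m := 3
  ar := ![k, k, 2]

/-- The endpoints of an edge in increasing order; comparing these pairs is the lexicographic
order on edges induced by the order of the vertices. -/
def edgeKey {V : Type} [LinearOrder V] {G : SimpleGraph V} (e : G.edgeSet) : V ×ₗ V :=
  toLex ((e : Sym2 V).inf, (e : Sym2 V).sup)

/-- The relation `R_j` of the gadget of the vertex `v` with charge `s`: the tuples
`((e_1, a_1), …, (e_k, a_k))`, with `e_1 < … < e_k` the edges at `v`, such that
`a_1 + … + a_k - 2 s` lies in `{0, 1}` (for `j = 0`) or in `{2, 3}` (for `j = 1`). -/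
def gadgetRel {V : Type} [LinearOrder V] (G : SimpleGraph V) (k : ℕ) (v : V) (s : ZMod 4)
    (j : Fin 2) : Set (Fin k → G.edgeSet × ZMod 4) :=
  {t | StrictMono (fun i => edgeKey (t i).1) ∧
    Set.range (fun i => ((t i).1 : Sym2 V)) = G.incidenceSet v ∧
    (∑ i, (t i).2) - 2 * s ∈ (![{0, 1}, {2, 3}] : Fin 2 → Set (ZMod 4)) j}

/-- The relation `R_j` of the whole structure: the union over all vertices of the gadget relations,
where exactly the vertices in `U` have charge `1`. -/
def cfiRel {V : Type} [LinearOrder V] (G : SimpleGraph V) (k : ℕ) (U : Set V) (j : Fin 2) :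
    Set (Fin k → G.edgeSet × ZMod 4) :=
  (⋃ v ∈ Uᶜ, gadgetRel G k v 0 j) ∪ ⋃ v ∈ U, gadgetRel G k v 1 j

/-- The preorder `≺`: `(e, a) ≺ (e', a')` if and only if `e ≤ e'`. -/
def cfiPreorder {V : Type} [LinearOrder V] (G : SimpleGraph V) :
    Set (Fin 2 → G.edgeSet × ZMod 4) :=
  {t | edgeKey (t 0).1 ≤ edgeKey (t 1).1}

/-- The CFI-like structure over the ordered `k`-regular graph `G` in which exactly the vertices
in `U` have charge `1`. -/
def cfi {V : Type} [Fintype V] [LinearOrder V] (G : SimpleGraph V) [Nonempty G.edgeSet] (k : ℕ)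
    (U : Set V) : FinStr (cfiVocabulary k) where
  carrier := G.edgeSet × ZMod 4
  finite := inferInstance
  nonempty := inferInstance
  rel := fun (i : Fin 3) => match i with
    | 0 => cfiRel G k U 0
    | 1 => cfiRel G k U 1
    | 2 => cfiPreorder G

/-- The untwisted structure. -/
def cfiUntwisted {V : Type} [Fintype V] [LinearOrder V] (G : SimpleGraph V)
    [Nonempty G.edgeSet] (k : ℕ) : FinStr (cfiVocabulary k) :=
  cfi G k ∅

/-- The twisted structure: only the smallest vertex has charge `1`. -/
def cfiTwisted {V : Type} [Fintype V] [LinearOrder V] (G : SimpleGraph V)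
    [Nonempty G.edgeSet] (k : ℕ) : FinStr (cfiVocabulary k) :=
  cfi G k {v | ∀ u, v ≤ u}

/-- The complete bipartite graph `K_{n,n}` minus a perfect matching. -/
def bicliqueMinusMatching (n : ℕ) : SimpleGraph (Fin n ⊕ Fin n) :=
  (completeBipartiteGraph (Fin n) (Fin n)).deleteEdges
    (Set.range fun i => s(Sum.inl i, Sum.inr i))

/-! A Maltsev-closed class is also closed under shrinking relations and under the full closure by
`m`. So if a bijection sends every tuple of a definable relation of `A` into the `m`-closure of the
corresponding relation of `B`, membership in the class passes from `B` to `A`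
(`quantifier_transfer`). A quantifier binds several variable tuples at once but needs one bijection
for all of them, so the strategy fixes the bijection before the variables are known. Such a uniform
strategy gives both logical equivalence (`IsUniformStrategy.sat_iff`) and a win in the game.

On the structures over `ZMod 4`, Duplicator keeps a map that is correct at all gadgets except that
of one vertex `v`, where an edge without a pebble hides the fault. As `k ≥ 3`, the fault can be
placed at a vertex with two free edges (`IsCfiPosition.exists_two_free_edges`). If Spoiler now
covers all edges at `v`, the image `t` of the chosen tuple may violate the gadget. But `t` is the
Maltsev combination of three tuples obtained by adding `δ` at the first, at both, or at the second
of two coordinates on those edges. The gadget sum changes by `δ` or `2δ`, and over `ZMod 4` some `δ`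
puts both results into the required class (`exists_class_shift`); over `ZMod 2` this fails because
`2δ = 0`. All three answers thus respect the gadget of `v`, and connectedness of the graph without
`v` lets the fault move to another vertex (`isCfiPosition_of_full`).

A quantifier of arity `k` without closure conditions can name an isomorphism type, so strictness
reduces to non-isomorphism. An isomorphism fixes every edge and, around each vertex, acts by
translations only or by reflections only. Double counting over the two sides of the bipartite graph
shows that it cannot create a single twist (`not_isomorphic_cfi`). -/

/-! ### Maltsev-closed quantifiers and the game -/

theorem Quantifier.MaltsevClosed.mem_of_subset_closure {Q : Quantifier} (hQ : Q.MaltsevClosed)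
    {B : FinStr Q.voc} (hB : B ∈ Q.cls) (R : ∀ i : Fin Q.voc.m, Set (Fin (Q.voc.ar i) → B.carrier))
    (hR : ∀ i, R i ⊆ MaltsevClosure (B.rel i)) : B.withRel R ∈ Q.cls := by
  have := B.finite
  let 𝒮 : Set (∀ i : Fin Q.voc.m, Set (Fin (Q.voc.ar i) → B.carrier)) :=
    {S | B.withRel S ∈ Q.cls ∧ ∀ i, B.rel i ⊆ S i}
  -- The universe is finite, so a maximal family in the class exists; adding its `m`-image stays in
  -- the class, hence adds nothing.
  obtain ⟨S, hS⟩ := (Set.toFinite 𝒮).exists_maximal ⟨B.rel, hB, fun i => subset_rfl⟩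
  have hmem : (fun i => S i ∪ maltsevImage (S i)) ∈ 𝒮 :=
    ⟨hQ _ hS.1.1 (fun i => S i ∪ maltsevImage (S i)) fun i => subset_rfl,
      fun i => (hS.1.2 i).trans Set.subset_union_left⟩
  have hle : ∀ i, maltsevImage (S i) ⊆ S i := fun i =>
    Set.subset_union_right.trans (hS.2 hmem (fun i => Set.subset_union_left) i)
  have hcl : ∀ i, MaltsevClosure (B.rel i) ⊆ S i := by
    intro i a ha
    induction ha with
    | base ha => exact hS.1.2 i ha
    | step _ _ _ h iha ihb ihc => exact hle i ⟨_, iha, _, ihb, _, ihc, h⟩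
  exact hQ _ hS.1.1 R fun i => ((hR i).trans (hcl i)).trans Set.subset_union_left

theorem MaltsevClosure.mono {A : Type} {r : ℕ} {P R : Set (Fin r → A)} (h : P ⊆ R) :
    MaltsevClosure P ⊆ MaltsevClosure R := by
  intro a ha
  induction ha with
  | base ha => exact MaltsevClosure.base (h ha)
  | step _ _ _ h iha ihb ihc => exact MaltsevClosure.step iha ihb ihc h

/-- A right move in which Duplicator chooses the bijection before Spoiler chooses the variables. -/
def UniformMove {k : ℕ} {σ : Vocabulary} (A B : FinStr σ)
    (W : PartialAssignment k A → PartialAssignment k B → Prop)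
    (α : PartialAssignment k A) (β : PartialAssignment k B) : Prop :=
  ∃ f : A.carrier ≃ B.carrier, ∀ (r : ℕ) (y : Fin r ↪ Fin k) (a : Fin r → A.carrier),
    ∃ p : Fin 3 → Fin r → B.carrier,
      (fun j => f (a j)) ∈ MaltsevClosure (Set.range p) ∧
      ∀ b ∈ Set.range p, W (α.subst y a) (β.subst y b)

/-- A winning strategy in the game with uniform moves. -/
def IsUniformStrategy {k : ℕ} {σ : Vocabulary} (A B : FinStr σ)
    (W : PartialAssignment k A → PartialAssignment k B → Prop) : Prop :=
  ∀ α β, W α β → IsPartialIso A B α β ∧ UniformMove A B W α β ∧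
    UniformMove B A (fun β α => W α β) β α

theorem IsUniformStrategy.duplicatorWins {k : ℕ} {σ : Vocabulary} {A B : FinStr σ}
    {W : PartialAssignment k A → PartialAssignment k B → Prop} (hW : IsUniformStrategy A B W)
    {α : PartialAssignment k A} {β : PartialAssignment k B} (h : W α β) :
    DuplicatorWins k A B α β := by
  refine ⟨W, h, fun α β hαβ => ?_⟩
  obtain ⟨h₁, ⟨f, hf⟩, g, hg⟩ := hW α β hαβ
  exact ⟨h₁, fun r _ _ y => ⟨g, hg r y⟩, fun r _ _ y => ⟨f, hf r y⟩⟩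

theorem PartialAssignment.subst_eq_some {k : ℕ} {σ : Vocabulary} {A : FinStr σ} {r : ℕ}
    {α : PartialAssignment k A} {α' : Fin k → A.carrier} {S : Set (Fin k)} (y : Fin r ↪ Fin k)
    (a : Fin r → A.carrier) (h : ∀ x ∈ S \ Set.range y, α x = some (α' x)) :
    ∀ x ∈ S, α.subst y a x = some (Function.extend y a α' x) := by
  intro x hx
  by_cases hy : x ∈ Set.range y
  · obtain ⟨j, rfl⟩ := hy
    exact (y.injective.extend_apply _ _ j).trans
      (congrArg some (y.injective.extend_apply a α' j).symm)
  · have : ¬ ∃ j, y j = x := hy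
    exact (Function.extend_apply' _ _ _ this).trans ((h x ⟨hx, hy⟩).trans
      (congrArg some (Function.extend_apply' a α' x this).symm))

/-- One direction of the induction step for a Maltsev-closed quantifier. -/
theorem quantifier_transfer {k : ℕ} {σ : Vocabulary} {A B : FinStr σ}
    {W : PartialAssignment k A → PartialAssignment k B → Prop}
    {Q : Quantifier} (hQ : Q.MaltsevClosed) {α : PartialAssignment k A} {β : PartialAssignment k B}
    (hm : UniformMove A B W α β) (y : ∀ i : Fin Q.voc.m, Fin (Q.voc.ar i) ↪ Fin k)
    (R : ∀ i : Fin Q.voc.m, Set (Fin (Q.voc.ar i) → A.carrier))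
    (S : ∀ i : Fin Q.voc.m, Set (Fin (Q.voc.ar i) → B.carrier))
    (hRS : ∀ i a b, W (α.subst (y i) a) (β.subst (y i) b) → (a ∈ R i ↔ b ∈ S i))
    (hS : B.withRel S ∈ Q.cls) : A.withRel R ∈ Q.cls := by
  obtain ⟨f, hf⟩ := hm
  have h₁ : B.withRel (fun i => {b | (fun j => f.symm (b j)) ∈ R i}) ∈ Q.cls := by
    refine hQ.mem_of_subset_closure hS (fun i => {b | (fun j => f.symm (b j)) ∈ R i})
      fun i b hb => ?_
    obtain ⟨p, hp, hpW⟩ := hf _ (y i) (fun j => f.symm (b j))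
    rw [show (fun j => f (f.symm (b j))) = b from funext fun j => f.apply_symm_apply (b j)] at hp
    -- All three answers to a tuple of `R i` lie in `S i`, so the image of that tuple lies in the
    -- closure of `S i`.
    exact MaltsevClosure.mono (fun c hc => (hRS i _ c (hpW c hc)).1 hb) hp
  refine Q.iso_closed _ _ ⟨f.symm, fun i t => ?_⟩ h₁
  rfl

theorem IsUniformStrategy.sat_iff {k : ℕ} {σ : Vocabulary} {A B : FinStr σ}
    {W : PartialAssignment k A → PartialAssignment k B → Prop} (hW : IsUniformStrategy A B W)
    (φ : Formula σ k (maltsevQuantifiersOfArity k)) :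
    ∀ (α : PartialAssignment k A) (β : PartialAssignment k B) (α' : Fin k → A.carrier)
      (β' : Fin k → B.carrier), W α β → (∀ x ∈ φ.freeVars, α x = some (α' x)) →
      (∀ x ∈ φ.freeVars, β x = some (β' x)) → (φ.Sat A α' ↔ φ.Sat B β') := by
  induction φ with
  | eq x y =>
    intro α β α' β' h hα hβ
    have := (hW _ _ h).1.2.1 x y
    rw [hα x (by simp [Formula.freeVars]), hα y (by simp [Formula.freeVars]),
      hβ x (by simp [Formula.freeVars]), hβ y (by simp [Formula.freeVars])] at this
    simpa [Formula.Sat] using this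
  | rel i x =>
    intro α β α' β' h hα hβ
    exact (hW _ _ h).1.2.2 i x _ _ (fun j => hα _ ⟨j, rfl⟩) (fun j => hβ _ ⟨j, rfl⟩)
  | neg φ ih =>
    intro α β α' β' h hα hβ
    exact not_congr (ih α β α' β' h hα hβ)
  | conj φ ih =>
    intro α β α' β' h hα hβ
    exact forall_congr' fun i => ih i α β α' β' h
      (fun x hx => hα x (Set.mem_iUnion.2 ⟨i, hx⟩)) (fun x hx => hβ x (Set.mem_iUnion.2 ⟨i, hx⟩))
  | ex x φ ih =>
    intro α β α' β' h hα hβ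
    obtain ⟨-, ⟨f, hf⟩, g, hg⟩ := hW _ _ h
    let y : Fin 1 ↪ Fin k := ⟨fun _ => x, fun _ _ _ => Subsingleton.elim _ _⟩
    have hy : Set.range y = {x} := Set.range_const
    have hupd : ∀ {C : Type} (γ : Fin k → C) (c : Fin 1 → C),
        Function.extend y c γ = Function.update γ x (c 0) := by
      intro C γ c
      ext z
      by_cases hz : z = x
      · subst hz
        rw [Function.update_self]
        exact y.injective.extend_apply c γ 0
      · rw [Function.update_of_ne hz, Function.extend_apply']
        rintro ⟨j, rfl⟩
        exact hz rfl
    have key : ∀ (a : Fin 1 → A.carrier) (b : Fin 1 → B.carrier),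
        W (α.subst y a) (β.subst y b) →
        (φ.Sat A (Function.update α' x (a 0)) ↔ φ.Sat B (Function.update β' x (b 0))) := by
      intro a b hab
      rw [← hupd, ← hupd]
      exact ih _ _ _ _ hab
        (PartialAssignment.subst_eq_some y a (by rw [hy]; exact hα))
        (PartialAssignment.subst_eq_some y b (by rw [hy]; exact hβ))
    constructor
    · rintro ⟨a, ha⟩
      -- The closure condition is irrelevant for `∃`: any of the three answers is a witness.
      obtain ⟨p, -, hp⟩ := hf 1 y fun _ => a
      exact ⟨_, (key _ _ (hp (p 0) ⟨0, rfl⟩)).1 ha⟩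
    · rintro ⟨b, hb⟩
      obtain ⟨p, -, hp⟩ := hg 1 y fun _ => b
      exact ⟨_, (key _ _ (hp (p 0) ⟨0, rfl⟩)).2 hb⟩
  | quant Q hQ y ψ ih =>
    intro α β α' β' h hα hβ
    obtain ⟨-, hr, hl⟩ := hW _ _ h
    have key : ∀ i a b, W (α.subst (y i) a) (β.subst (y i) b) →
        (a ∈ {a | (ψ i).Sat A (Function.extend (y i) a α')} ↔
          b ∈ {b | (ψ i).Sat B (Function.extend (y i) b β')}) := fun i a b hab =>
      ih i _ _ _ _ hab
        (PartialAssignment.subst_eq_some (y i) a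
          fun x hx => hα x (Set.mem_iUnion.2 ⟨i, hx⟩))
        (PartialAssignment.subst_eq_some (y i) b
          fun x hx => hβ x (Set.mem_iUnion.2 ⟨i, hx⟩))
    exact ⟨quantifier_transfer hQ.1 hl y _ _ fun i a b hab => (key i b a hab).symm,
      quantifier_transfer hQ.1 hr y _ _ key⟩

theorem IsUniformStrategy.models_iff {k : ℕ} {σ : Vocabulary} {A B : FinStr σ}
    {W : PartialAssignment k A → PartialAssignment k B → Prop} (hW : IsUniformStrategy A B W)
    (h : W (fun _ => none) (fun _ => none)) (φ : Sentence σ k (maltsevQuantifiersOfArity k)) :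
    A.Models φ ↔ B.Models φ := by
  have key := fun α' β' => hW.sat_iff φ.1 _ _ α' β' h (by simp [φ.2]) (by simp [φ.2])
  obtain ⟨a⟩ := A.nonempty
  obtain ⟨b⟩ := B.nonempty
  exact ⟨fun hA β => (key (fun _ => a) β).1 (hA _), fun hB α => (key α fun _ => b).2 (hB _)⟩

/-! ### Enlarging the set of quantifiers; defining isomorphism types -/

/-- Formulas over a smaller collection of quantifiers, read over a larger one. -/
def Formula.lift {σ : Vocabulary} {k : ℕ} {𝒬 𝒬' : Set Quantifier} (h : 𝒬 ⊆ 𝒬') :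
    Formula σ k 𝒬 → Formula σ k 𝒬'
  | eq x y => eq x y
  | rel i x => rel i x
  | neg φ => neg (φ.lift h)
  | conj φ => conj fun i => (φ i).lift h
  | ex x φ => ex x (φ.lift h)
  | quant Q hQ y ψ => quant Q (h hQ) y fun i => (ψ i).lift h

theorem Formula.freeVars_lift {σ : Vocabulary} {k : ℕ} {𝒬 𝒬' : Set Quantifier} (h : 𝒬 ⊆ 𝒬')
    (φ : Formula σ k 𝒬) : (φ.lift h).freeVars = φ.freeVars := by
  induction φ <;> simp_all [Formula.lift, Formula.freeVars]

theorem Formula.sat_lift {σ : Vocabulary} {k : ℕ} {𝒬 𝒬' : Set Quantifier} (h : 𝒬 ⊆ 𝒬')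
    (A : FinStr σ) (φ : Formula σ k 𝒬) : ∀ α, (φ.lift h).Sat A α ↔ φ.Sat A α := by
  induction φ <;> simp_all [Formula.lift, Formula.Sat]

theorem logicLE_of_subset (k : ℕ) {𝒬 𝒬' : Set Quantifier} (h : 𝒬 ⊆ 𝒬') : LogicLE k 𝒬 𝒬' :=
  fun _ φ => ⟨⟨φ.1.lift h, (φ.1.freeVars_lift h).trans φ.2⟩,
    fun A => forall_congr' fun α => (φ.1.sat_lift h A α).symm⟩

theorem FinStr.Isomorphic.refl {σ : Vocabulary} (A : FinStr σ) : A.Isomorphic A :=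
  ⟨Equiv.refl _, fun _ _ => Iff.rfl⟩

theorem FinStr.Isomorphic.trans {σ : Vocabulary} {A B C : FinStr σ} (h₁ : A.Isomorphic B)
    (h₂ : B.Isomorphic C) : A.Isomorphic C := by
  obtain ⟨f, hf⟩ := h₁
  obtain ⟨g, hg⟩ := h₂
  exact ⟨f.trans g, fun i t => (hf i t).trans (hg i _)⟩

/-- The quantifier of the isomorphism type of `A`. -/
def isoTypeQuantifier {σ : Vocabulary} (A : FinStr σ) : Quantifier where
  voc := σ
  cls := {B | A.Isomorphic B}
  iso_closed _ _ h hA := FinStr.Isomorphic.trans hA h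

/-- A sentence that defines the isomorphism type of `A`. -/
def isoTypeSentence {σ : Vocabulary} {k : ℕ} (A : FinStr σ) (h : ∀ i, σ.ar i ≤ k) :
    Sentence σ k (quantifiersOfArity k) :=
  ⟨.quant (isoTypeQuantifier A) h (fun i => Fin.castLEEmb (h i))
    fun i => .rel i (Fin.castLE (h i)),
    Set.iUnion_eq_empty.2 fun _ => Set.sdiff_eq_empty.2 subset_rfl⟩

theorem models_isoTypeSentence {σ : Vocabulary} {k : ℕ} (A B : FinStr σ) (h : ∀ i, σ.ar i ≤ k) :
    B.Models (isoTypeSentence A h) ↔ A.Isomorphic B := by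
  have key : ∀ α : Fin k → B.carrier, (isoTypeSentence A h).1.Sat B α ↔ A.Isomorphic B := by
    intro α
    have : (B.withRel fun i => {b | (Formula.rel i (Fin.castLE (h i)) :
        Formula σ k (quantifiersOfArity k)).Sat B (Function.extend (Fin.castLEEmb (h i)) b α)})
        = B := by
      have : ∀ i (b : Fin (σ.ar i) → B.carrier),
          (fun j => Function.extend (Fin.castLEEmb (h i)) b α (Fin.castLE (h i) j)) = b :=
        fun i b => funext fun j => (Fin.castLEEmb (h i)).injective.extend_apply b α j
      simp only [Formula.Sat, FinStr.withRel, this, Set.ofPred_mem_eq]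
    change (B.withRel _) ∈ {B | A.Isomorphic B} ↔ _
    exact Iff.of_eq (congrArg A.Isomorphic this)
  obtain ⟨b⟩ := B.nonempty
  exact ⟨fun hB => (key fun _ => b).1 (hB _), fun hB α => (key α).2 hB⟩

/-! ### Edge labellings and their sums at vertices -/

section EdgesAt

variable {V : Type} {G : SimpleGraph V}

theorem eq_of_mem_two_edges {u v : V} (huv : u ≠ v) {d e : G.edgeSet} (hd : u ∈ (d : Sym2 V))
    (hd' : v ∈ (d : Sym2 V)) (he : u ∈ (e : Sym2 V)) (he' : v ∈ (e : Sym2 V)) : d = e :=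
  Subtype.ext (((Sym2.mem_and_mem_iff huv).1 ⟨hd, hd'⟩).trans
    ((Sym2.mem_and_mem_iff huv).1 ⟨he, he'⟩).symm)

variable [Fintype V]

/-- The set of edges at a vertex. -/
noncomputable def edgesAt (G : SimpleGraph V) (v : V) : Finset G.edgeSet :=
  (Set.toFinite {e : G.edgeSet | v ∈ (e : Sym2 V)}).toFinset

@[simp]
theorem mem_edgesAt {v : V} {e : G.edgeSet} : e ∈ edgesAt G v ↔ v ∈ (e : Sym2 V) := by
  simp [edgesAt]

/-- The sum of an edge labelling over the edges at a vertex. -/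
noncomputable def vertexSum {M : Type*} [AddCommMonoid M] (c : G.edgeSet → M) (v : V) : M :=
  ∑ e ∈ edgesAt G v, c e

theorem vertexSum_congr {M : Type*} [AddCommMonoid M] {c d : G.edgeSet → M} {v : V}
    (h : ∀ e ∈ edgesAt G v, c e = d e) : vertexSum c v = vertexSum d v :=
  Finset.sum_congr rfl h

theorem vertexSum_add {M : Type*} [AddCommMonoid M] (c d : G.edgeSet → M) (v : V) :
    vertexSum (fun e => c e + d e) v = vertexSum c v + vertexSum d v :=
  Finset.sum_add_distrib

theorem vertexSum_sub {M : Type*} [AddCommGroup M] (c d : G.edgeSet → M) (v : V) :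
    vertexSum (fun e => c e - d e) v = vertexSum c v - vertexSum d v :=
  Finset.sum_sub_distrib _ _

theorem vertexSum_mul {R : Type*} [NonUnitalNonAssocSemiring R] (a : R) (c : G.edgeSet → R)
    (v : V) : vertexSum (fun e => a * c e) v = a * vertexSum c v :=
  (Finset.mul_sum _ _ _).symm

theorem vertexSum_single {M : Type*} [AddCommMonoid M] [DecidableEq G.edgeSet] (e : G.edgeSet)
    (a : M) (v : V) [Decidable (v ∈ (e : Sym2 V))] :
    vertexSum (Pi.single e a) v = if v ∈ (e : Sym2 V) then a else 0 := by
  simp [vertexSum]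

theorem vertexSum_zero {M : Type*} [AddCommMonoid M] (v : V) :
    vertexSum (fun _ : G.edgeSet => (0 : M)) v = 0 :=
  Finset.sum_const_zero

theorem vertexSum_finset_sum {M ι : Type*} [AddCommMonoid M] (s : Finset ι)
    (c : ι → G.edgeSet → M) (v : V) :
    vertexSum (fun e => ∑ i ∈ s, c i e) v = ∑ i ∈ s, vertexSum (c i) v :=
  Finset.sum_comm

/-- A sum over an enumeration of the edges at a vertex. -/
theorem sum_eq_vertexSum {M : Type*} [AddCommMonoid M] {k : ℕ} {v : V} {e : Fin k → G.edgeSet}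
    (he : Function.Injective e) (hv : ∀ d, d ∈ edgesAt G v ↔ ∃ i, e i = d)
    (c : G.edgeSet → M) : ∑ i, c (e i) = vertexSum c v := by
  classical
  rw [vertexSum, show edgesAt G v = Finset.univ.image e by ext d; simp [hv d],
    Finset.sum_image he.injOn]

/-- Two distinct edges share at most one vertex, so two edges at `u` already determine `u`. -/
theorem edgesAt_injective {k : ℕ} (hk : 2 ≤ k) (hreg : ∀ v, (edgesAt G v).card = k) {u v : V}
    (h : ∀ e : G.edgeSet, u ∈ (e : Sym2 V) → v ∈ (e : Sym2 V)) : u = v := by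
  by_contra huv
  obtain ⟨d, hd, e, he, hde⟩ := Finset.one_lt_card.1 (hk.trans_eq (hreg u).symm)
  rw [mem_edgesAt] at hd he
  exact hde (eq_of_mem_two_edges huv hd (h d hd) he (h e he))

theorem exists_of_range_eq {k : ℕ} {v : V} {t : Fin k → G.edgeSet}
    (h : Set.range (fun i => (t i : Sym2 V)) = G.incidenceSet v) (d : G.edgeSet) :
    d ∈ edgesAt G v ↔ ∃ i, t i = d := by
  have := Set.ext_iff.1 h d
  simp only [Set.mem_range, SimpleGraph.incidenceSet] at this
  simp only [mem_edgesAt]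
  grind

theorem range_eq_of_forall {k : ℕ} {v : V} {t : Fin k → G.edgeSet}
    (h : ∀ d, d ∈ edgesAt G v ↔ ∃ i, t i = d) :
    Set.range (fun i => (t i : Sym2 V)) = G.incidenceSet v := by
  ext d
  constructor
  · rintro ⟨i, rfl⟩
    exact ⟨(t i).2, mem_edgesAt.1 ((h _).2 ⟨i, rfl⟩)⟩
  · rintro ⟨hd, hv⟩
    obtain ⟨i, hi⟩ := (h ⟨d, hd⟩).1 (mem_edgesAt.2 hv)
    exact ⟨i, congrArg Subtype.val hi⟩

end EdgesAt

/-! ### Charges and the symmetries of the class `{0, 1}` -/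

section Charge

variable {V : Type} [LinearOrder V] {G : SimpleGraph V}

/-- The charge of a vertex. -/
noncomputable def charge (U : Set V) (v : V) : ZMod 4 :=
  U.indicator 1 v

theorem mem_cfiRel {k : ℕ} {U : Set V} {j : Fin 2} {t : Fin k → G.edgeSet × ZMod 4} :
    t ∈ cfiRel G k U j ↔ ∃ v, t ∈ gadgetRel G k v (charge U v) j := by
  classical
  simp only [cfiRel, Set.mem_union, Set.mem_iUnion, charge, Set.indicator_apply]
  constructor
  · rintro (⟨v, hv, h⟩ | ⟨v, hv, h⟩)
    · exact ⟨v, by rwa [if_neg hv]⟩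
    · exact ⟨v, by rwa [if_pos hv]⟩
  · rintro ⟨v, h⟩
    by_cases hv : v ∈ U
    · exact .inr ⟨v, hv, by rwa [if_pos hv] at h⟩
    · exact .inl ⟨v, hv, by rwa [if_neg hv] at h⟩

theorem edgeKey_injective : Function.Injective (edgeKey : G.edgeSet → V ×ₗ V) := by
  intro d e h
  have h' := Prod.ext_iff.1 (toLex.injective h)
  exact Subtype.ext (Sym2.inf_eq_inf_and_sup_eq_sup.1 h')

end Charge

/-- The pairs `(1, 0)` and `(-1, 1)`; precisely for these, the map `x ↦ ε * x + τ` is a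
bijection of `ZMod 4` that preserves the set `{0, 1}`. -/
def IsClassPreserving (ε τ : ZMod 4) : Prop :=
  ε = 1 ∧ τ = 0 ∨ ε = -1 ∧ τ = 1

instance (ε τ : ZMod 4) : Decidable (IsClassPreserving ε τ) :=
  inferInstanceAs (Decidable (_ ∨ _))

theorem IsClassPreserving.mul_self {ε τ : ZMod 4} (h : IsClassPreserving ε τ) : ε * ε = 1 := by
  revert ε τ; decide

theorem IsClassPreserving.mul_offset {ε τ : ZMod 4} (h : IsClassPreserving ε τ) :
    -ε * τ = τ := by
  revert ε τ; decide

theorem IsClassPreserving.mul_two {ε τ : ZMod 4} (h : IsClassPreserving ε τ) :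
    ε * 2 = 2 := by
  revert ε τ; decide

theorem IsClassPreserving.mem_iff {ε τ : ZMod 4} (h : IsClassPreserving ε τ) (j : Fin 2)
    (x : ZMod 4) : ε * x + τ ∈ (![{0, 1}, {2, 3}] : Fin 2 → Set (ZMod 4)) j ↔
      x ∈ (![{0, 1}, {2, 3}] : Fin 2 → Set (ZMod 4)) j := by
  fin_cases j <;>
    simp only [Fin.zero_eta, Fin.mk_one, Matrix.cons_val_zero, Matrix.cons_val_one,
      Set.mem_insert_iff, Set.mem_singleton_iff] <;> revert x ε τ <;> decide

theorem exists_isClassPreserving : ∀ x y : ZMod 4, (x = 0 ∨ x = 1 ↔ y = 0 ∨ y = 1) →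
    ∃ ε τ, IsClassPreserving ε τ ∧ ε * x + τ = y := by
  decide

/-- This is where `ZMod 4` matters: from outside a class, two equal steps of `1` or `-1` can both
land in it. -/
theorem exists_class_shift : ∀ x y : ZMod 4, ∃ δ, (x = 0 ∨ x = 1 ↔ y + δ = 0 ∨ y + δ = 1) ∧
    (x = 0 ∨ x = 1 ↔ y + δ + δ = 0 ∨ y + δ + δ = 1) := by
  decide

/-! ### Duplicator's strategy -/

section Game

variable {V : Type} [Fintype V] {G : SimpleGraph V} {k : ℕ} {U U' : Set V}

/-- The positions of Duplicator's winning strategy: `β` is the image of `α` under a map that is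
affine on every edge and respects the gadgets of all vertices except `v`, which has an edge that
carries no pebble. -/
def IsCfiPosition (G : SimpleGraph V) (k : ℕ) (U U' : Set V)
    (α β : Fin k → Option (G.edgeSet × ZMod 4)) : Prop :=
  ∃ (ε τ : ZMod 4) (c : G.edgeSet → ZMod 4) (v : V), IsClassPreserving ε τ ∧
    (∀ u ≠ v, vertexSum c u = τ + 2 * (charge U u + charge U' u)) ∧
    (∀ x, β x = (α x).map fun p => (p.1, ε * p.2 + c p.1)) ∧
    ∃ e ∈ edgesAt G v, ∀ x a, α x ≠ some (e, a)

/-- The inverse of `a ↦ ε * a + c` is `b ↦ ε * b - ε * c`, because `ε * ε = 1`; signs do not matter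
for multiples of `2`, and `-ε * τ = τ`. -/
theorem IsCfiPosition.symm {α β : Fin k → Option (G.edgeSet × ZMod 4)}
    (h : IsCfiPosition G k U U' α β) : IsCfiPosition G k U' U β α := by
  obtain ⟨ε, τ, c, v, hε, hc, hβ, e, he, hα⟩ := h
  refine ⟨ε, τ, fun e => -ε * c e, v, hε, fun u hu => ?_, fun x => ?_, e, he, fun x a hx => ?_⟩
  · have h4 : (4 : ZMod 4) = 0 := rfl
    rw [vertexSum_mul, hc u hu]
    linear_combination hε.mul_offset - (charge U u + charge U' u) * hε.mul_two -
      (charge U u + charge U' u) * h4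
  · rw [hβ]
    cases α x with
    | none => rfl
    | some p =>
      refine congrArg some (Prod.ext rfl ?_)
      linear_combination -p.2 * hε.mul_self
  · rw [hβ, Option.map_eq_some_iff] at hx
    obtain ⟨⟨d, b⟩, hd, heq⟩ := hx
    obtain rfl : d = e := congrArg Prod.fst heq
    exact hα x b hd

/-- Duplicator can assume that the exceptional vertex has two edges that carry no pebbles. -/
theorem IsCfiPosition.exists_two_free_edges (hk : 3 ≤ k) (hreg : ∀ v, (edgesAt G v).card = k)
    {α β : Fin k → Option (G.edgeSet × ZMod 4)} (h : IsCfiPosition G k U U' α β) :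
    ∃ (ε τ : ZMod 4) (c : G.edgeSet → ZMod 4) (v : V), IsClassPreserving ε τ ∧
      (∀ u ≠ v, vertexSum c u = τ + 2 * (charge U u + charge U' u)) ∧
      (∀ x, β x = (α x).map fun p => (p.1, ε * p.2 + c p.1)) ∧
      ∃ d ∈ edgesAt G v, ∃ e ∈ edgesAt G v, d ≠ e ∧ (∀ x a, α x ≠ some (d, a)) ∧
        ∀ x a, α x ≠ some (e, a) := by
  classical
  obtain ⟨ε, τ, c, v, hε, hc, hβ, e, he, hα⟩ := h
  by_cases hd : ∃ d ∈ edgesAt G v, e ≠ d ∧ ∀ x a, α x ≠ some (d, a)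
  · obtain ⟨d, hd, hed, hαd⟩ := hd
    exact ⟨ε, τ, c, v, hε, hc, hβ, e, he, d, hd, hed, hα, hαd⟩
  -- If `e` is the only free edge at `v`, then `k - 1` of the at most `k` pebbled edges are at `v`.
  -- The other endpoint `u` of `e` shares only `e` with `v`, so at most one edge at `u` is pebbled
  -- and `k - 1 ≥ 2` are free.
  obtain ⟨u, hu⟩ : ∃ u, (e : Sym2 V) = s(v, u) := mem_edgesAt.1 he
  have huv : u ≠ v := by
    rintro rfl
    exact G.irrefl (G.mem_edgeSet.1 (hu ▸ e.2))
  have hvu : ∀ d ∈ edgesAt G v, d ∈ edgesAt G u → d = e := fun d hd hd' =>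
    eq_of_mem_two_edges huv (mem_edgesAt.1 hd') (mem_edgesAt.1 hd) (by simp [hu]) (by simp [hu])
  have heu : e ∈ edgesAt G u := by simp [hu]
  set P : Finset G.edgeSet := Finset.univ.filter fun d => ∃ x a, α x = some (d, a) with hP
  have hPk : P.card ≤ k := by
    have : P ⊆ Finset.univ.biUnion fun x => ((α x).map Prod.fst).toFinset := by
      intro d hd
      obtain ⟨x, a, hx⟩ := (Finset.mem_filter.1 hd).2
      simp only [Finset.mem_biUnion, Finset.mem_univ, true_and]
      exact ⟨x, by simp [hx]⟩
    refine (Finset.card_le_card this).trans (Finset.card_biUnion_le.trans ?_)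
    calc _ ≤ ∑ _x : Fin k, 1 := Finset.sum_le_sum fun x _ => by
            cases α x <;> simp
      _ = k := by simp
  have hPv : (edgesAt G v).erase e ⊆ P := by
    intro d hd'
    rw [Finset.mem_erase] at hd'
    by_contra hdP
    refine hd ⟨d, hd'.2, hd'.1.symm, fun x a hx => hdP ?_⟩
    exact Finset.mem_filter.2 ⟨Finset.mem_univ _, x, a, hx⟩
  have hsub : P.filter (· ∈ edgesAt G u) ⊆ P \ (edgesAt G v).erase e := by
    intro d hd'
    rw [Finset.mem_filter] at hd'
    rw [Finset.mem_sdiff, Finset.mem_erase]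
    exact ⟨hd'.1, fun h => h.1 (hvu d h.2 hd'.2)⟩
  have hcard := Finset.card_le_card hsub
  rw [Finset.card_sdiff_of_subset hPv, Finset.card_erase_of_mem he, hreg] at hcard
  have hfree : 1 < ((edgesAt G u) \ P.filter (· ∈ edgesAt G u)).card := by
    have := Finset.le_card_sdiff (P.filter (· ∈ edgesAt G u)) (edgesAt G u)
    rw [hreg] at this
    omega
  obtain ⟨d, hd, d', hd', hne⟩ := Finset.one_lt_card.1 hfree
  have hfree' : ∀ d ∈ (edgesAt G u) \ P.filter (· ∈ edgesAt G u), d ∈ edgesAt G u ∧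
      ∀ x a, α x ≠ some (d, a) := by
    intro d hd
    rw [Finset.mem_sdiff] at hd
    refine ⟨hd.1, fun x a hx => hd.2 ?_⟩
    exact Finset.mem_filter.2 ⟨Finset.mem_filter.2 ⟨Finset.mem_univ _, x, a, hx⟩, hd.1⟩
  -- Changing the label of the unpebbled edge `e` repairs the sum at `v` and moves the fault to `u`,
  -- without affecting any pebble.
  refine ⟨ε, τ, fun d => c d + (Pi.single e
    (τ + 2 * (charge U v + charge U' v) - vertexSum c v) : G.edgeSet → ZMod 4) d, u, hε, fun w hw => ?_, fun x => ?_,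
    d, (hfree' d hd).1, d', (hfree' d' hd').1, hne, (hfree' d hd).2, (hfree' d' hd').2⟩
  · rw [vertexSum_add, vertexSum_single]
    by_cases hwv : w = v
    · subst hwv
      simp [hu]
    · simp [hu, hw, hwv, hc]
  · rw [hβ]
    cases hx : α x with
    | none => rfl
    | some p =>
      have : p.1 ≠ e := by
        rintro rfl
        exact hα x p.2 hx
      simp [this]

/-- Edge labellings with prescribed sums at all vertices but one exist, even if the labels at the
vertex `v` are prescribed, and the exceptional vertex can be chosen independently of the sums. -/
def HasExtensions (G : SimpleGraph V) : Prop :=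
  ∀ v : V, ∃ w ≠ v, ∀ (c : G.edgeSet → ZMod 4) (s : V → ZMod 4), ∃ c' : G.edgeSet → ZMod 4,
    (∀ e ∈ edgesAt G v, c' e = c e) ∧ ∀ u ≠ w, u ≠ v → vertexSum c' u = s u

/-- If the gadget of `v` is respected, then it does not matter that all its edges carry pebbles. -/
theorem isCfiPosition_of_full (hk : 2 ≤ k) (hreg : ∀ v, (edgesAt G v).card = k)
    (hext : HasExtensions G) {v : V} {α β : Fin k → Option (G.edgeSet × ZMod 4)}
    {e : Fin k → G.edgeSet} (he : Function.Injective e)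
    (hv : ∀ d, d ∈ edgesAt G v ↔ ∃ x, e x = d) {p q : Fin k → ZMod 4}
    (hα : ∀ x, α x = some (e x, p x)) (hβ : ∀ x, β x = some (e x, q x))
    (hpq : (∑ x, p x - 2 * charge U v = 0 ∨ ∑ x, p x - 2 * charge U v = 1) ↔
      (∑ x, q x - 2 * charge U' v = 0 ∨ ∑ x, q x - 2 * charge U' v = 1)) :
    IsCfiPosition G k U U' α β := by
  obtain ⟨ε, τ, hε, hετ⟩ := exists_isClassPreserving _ _ hpq
  obtain ⟨w, hwv, hw⟩ := hext v
  -- At `v` the labels are forced by the pebbles; elsewhere only the sums are prescribed.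
  obtain ⟨c, hc, hcs⟩ := hw (Function.extend e (fun x => q x - ε * p x) 0)
    fun u => τ + 2 * (charge U u + charge U' u)
  have hce : ∀ x, c (e x) = q x - ε * p x := fun x => by
    rw [hc _ ((hv _).2 ⟨x, rfl⟩), he.extend_apply]
  refine ⟨ε, τ, c, w, hε, fun u hu => ?_, fun x => ?_, ?_⟩
  · by_cases huv : u = v
    · subst huv
      rw [← sum_eq_vertexSum he hv]
      simp only [hce, Finset.sum_sub_distrib, ← Finset.mul_sum]
      have h4 : (4 : ZMod 4) = 0 := rfl
      linear_combination -hετ - charge U u * hε.mul_two - charge U u * h4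
    · exact hcs u hu huv
  · rw [hα, hβ]
    simp [hce]
  · by_contra hcon
    push Not at hcon
    refine hwv (edgesAt_injective hk hreg fun d hd => ?_)
    obtain ⟨x, a, hx⟩ := hcon d (mem_edgesAt.2 hd)
    rw [hα] at hx
    exact mem_edgesAt.1 ((hv d).2 ⟨x, congrArg Prod.fst (Option.some_injective _ hx)⟩)

theorem isCfiPosition_empty (hreg : ∀ v, (edgesAt G v).card = k) (hk : 1 ≤ k) (v : V) :
    IsCfiPosition G k ∅ {v} (fun _ => none) (fun _ => none) := by
  obtain ⟨e, he⟩ := Finset.card_pos.1 (hk.trans_eq (hreg v).symm)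
  refine ⟨1, 0, fun _ => 0, v, .inl ⟨rfl, rfl⟩, fun u hu => ?_, fun _ => rfl, e, he,
    fun _ _ => nofun⟩
  simp [vertexSum_zero, charge, hu]

variable [LinearOrder V]

theorem mem_gadgetRel_affine {ε τ s s' : ZMod 4} (hε : IsClassPreserving ε τ)
    {c : G.edgeSet → ZMod 4} {u : V} (hc : vertexSum c u = τ + 2 * (s + s')) {j : Fin 2}
    (t : Fin k → G.edgeSet × ZMod 4) :
    (fun i => ((t i).1, ε * (t i).2 + c (t i).1)) ∈ gadgetRel G k u s' j ↔
      t ∈ gadgetRel G k u s j := by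
  refine and_congr_right fun h₁ => and_congr_right fun h₂ => ?_
  have hinj : Function.Injective fun i => (t i).1 := fun i i' h =>
    h₁.injective (congrArg edgeKey h)
  have hsum : ∑ i, (ε * (t i).2 + c (t i).1) - 2 * s' = ε * (∑ i, (t i).2 - 2 * s) + τ := by
    rw [Finset.sum_add_distrib, ← Finset.mul_sum,
      sum_eq_vertexSum hinj (exists_of_range_eq h₂) c, hc]
    have h4 : (4 : ZMod 4) = 0 := rfl
    linear_combination s * hε.mul_two + s * h4
  rw [hsum, hε.mem_iff]

/-- The gadget of `v` is never tested: its tuples use every edge at `v`, and one of them is free. At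
all other vertices the affine map preserves the gadget. -/
theorem IsCfiPosition.isPartialIso [Nonempty G.edgeSet]
    {α β : Fin k → Option (G.edgeSet × ZMod 4)}
    (h : IsCfiPosition G k U U' α β) : IsPartialIso (cfi G k U) (cfi G k U') α β := by
  obtain ⟨ε, τ, c, v, hε, hc, hβ, e, he, hα⟩ := h
  have hinj : Function.Injective
      fun p : G.edgeSet × ZMod 4 => (p.1, ε * p.2 + c p.1) := by
    rintro ⟨d, a⟩ ⟨d', a'⟩ h
    obtain rfl : d = d' := congrArg Prod.fst h
    have h' : ε * a + c d = ε * a' + c d := congrArg Prod.snd h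
    refine Prod.ext rfl ?_
    linear_combination ε * h' - (a - a') * hε.mul_self
  have hgad : ∀ (j : Fin 2) (x : Fin k → Fin k) (a b : Fin k → G.edgeSet × ZMod 4),
      (∀ i, α (x i) = some (a i)) → (∀ i, b i = ((a i).1, ε * (a i).2 + c (a i).1)) →
      (a ∈ cfiRel G k U j ↔ b ∈ cfiRel G k U' j) := by
    intro j x a b ha hb
    obtain rfl : b = _ := funext hb
    rw [mem_cfiRel, mem_cfiRel]
    refine exists_congr fun u => ?_
    by_cases hu : u = v
    · subst hu
      have key : ¬ Set.range (fun i => ((a i).1 : Sym2 V)) = G.incidenceSet u := by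
        intro hr
        obtain ⟨i, hi⟩ := (exists_of_range_eq hr e).1 he
        exact hα (x i) (a i).2 (by rw [ha i, ← hi])
      exact ⟨fun h => (key h.2.1).elim, fun h => (key h.2.1).elim⟩
    · exact (mem_gadgetRel_affine hε (hc u hu) a).symm
  have hnone : ∀ x, α x = none ↔ β x = none := fun x => by rw [hβ, Option.map_eq_none_iff]
  have heq : ∀ x y, α x = α y ↔ β x = β y := fun x y => by
    rw [hβ, hβ, (Option.map_injective hinj).eq_iff]
  refine ⟨hnone, heq, fun i x a b ha hb => ?_⟩
  · have hb' : ∀ j, b j = ((a j).1, ε * (a j).2 + c (a j).1) := by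
      intro j
      have := hβ (x j)
      rw [ha j, hb j] at this
      exact Option.some_injective _ this
    match i, x, a, b, ha, hb' with
    | 0, x, a, b, ha, hb => exact hgad 0 x a b ha hb
    | 1, x, a, b, ha, hb => exact hgad 1 x a b ha hb
    | 2, x, a, b, ha, hb =>
      obtain rfl : b = _ := funext hb
      exact Iff.rfl

theorem IsCfiPosition.uniformMove [Nonempty G.edgeSet] (hk : 3 ≤ k)
    (hreg : ∀ v, (edgesAt G v).card = k) (hext : HasExtensions G)
    {α β : Fin k → Option (G.edgeSet × ZMod 4)}
    (h : IsCfiPosition G k U U' α β) :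
    UniformMove (cfi G k U) (cfi G k U') (IsCfiPosition G k U U') α β := by
  classical
  obtain ⟨ε, τ, c, v, hε, hc, hβ, d₁, hd₁, d₂, hd₂, hne, hfree₁, hfree₂⟩ :=
    h.exists_two_free_edges hk hreg
  let f : G.edgeSet × ZMod 4 ≃ G.edgeSet × ZMod 4 :=
    { toFun := fun p => (p.1, ε * p.2 + c p.1)
      invFun := fun p => (p.1, ε * (p.2 - c p.1))
      left_inv := fun p => Prod.ext rfl (by linear_combination p.2 * hε.mul_self)
      right_inv := fun p => Prod.ext rfl (by linear_combination (p.2 - c p.1) * hε.mul_self) }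
  suffices key : ∀ (r : ℕ) (y : Fin r ↪ Fin k) (a : Fin r → G.edgeSet × ZMod 4),
      ∃ p : Fin 3 → Fin r → G.edgeSet × ZMod 4,
        (fun j => f (a j)) ∈ MaltsevClosure (Set.range p) ∧
        ∀ i, IsCfiPosition G k U U' (Function.extend y (fun j => some (a j)) α)
          (Function.extend y (fun j => some (p i j)) β) by
    refine ⟨f, fun r y a => ?_⟩
    obtain ⟨p, hp, hW⟩ := key r y a
    refine ⟨p, hp, ?_⟩
    rintro _ ⟨i, rfl⟩
    exact hW i
  intro r y a
  set α' := Function.extend y (fun j => some (a j)) α with hα'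
  have hα'y : ∀ j, α' (y j) = some (a j) := fun j => y.injective.extend_apply _ _ j
  have hα'n : ∀ x, (¬ ∃ j, y j = x) → α' x = α x := fun x hx => Function.extend_apply' _ _ _ hx
  by_cases hfull : ∃ e ∈ edgesAt G v, ∀ x b, α' x ≠ some (e, b)
  · refine ⟨fun _ j => f (a j), .base ⟨0, rfl⟩, fun _ => ⟨ε, τ, c, v, hε, hc, fun x => ?_, hfull⟩⟩
    by_cases hx : ∃ j, y j = x
    · obtain ⟨j, rfl⟩ := hx
      rw [hα'y, y.injective.extend_apply]
      rfl
    · rw [hα'n x hx, Function.extend_apply' _ _ _ hx, hβ]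
  push Not at hfull
  -- Now `k` pebbles cover the `k` edges at `v`, so each of these edges carries exactly one pebble
  -- and there are no others. In particular `d₁` and `d₂` received theirs in this move.
  choose X B hXB using fun e : edgesAt G v => hfull e.1 e.2
  have hXinj : Function.Injective X := fun d e hde => by
    have h := hXB d
    rw [hde, hXB e] at h
    exact Subtype.ext (congrArg Prod.fst (Option.some_injective _ h)).symm
  let σ : edgesAt G v ≃ Fin k := Equiv.ofBijective X
    ((Fintype.bijective_iff_injective_and_card X).2 ⟨hXinj, by rw [Fintype.card_coe, hreg, Fintype.card_fin]⟩)
  let e : Fin k → G.edgeSet := fun x => (σ.symm x).1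
  let p : Fin k → ZMod 4 := fun x => B (σ.symm x)
  have hα'e : ∀ x, α' x = some (e x, p x) := fun x => by
    have := hXB (σ.symm x)
    rwa [show X (σ.symm x) = x from σ.apply_symm_apply x] at this
  have he : Function.Injective e := Subtype.val_injective.comp σ.symm.injective
  have hv : ∀ d, d ∈ edgesAt G v ↔ ∃ x, e x = d := fun d =>
    ⟨fun hd => ⟨σ ⟨d, hd⟩, congrArg Subtype.val (σ.symm_apply_apply ⟨d, hd⟩)⟩,
      fun ⟨x, hx⟩ => hx ▸ (σ.symm x).2⟩
  have hnew : ∀ d ∈ edgesAt G v, (∀ x b, α x ≠ some (d, b)) → ∃ j, e (y j) = d := by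
    intro d hd hfree
    obtain ⟨x, rfl⟩ := (hv d).1 hd
    by_contra hcon
    refine hfree x (p x) ((hα'n x ?_).symm.trans (hα'e x))
    rintro ⟨j, rfl⟩
    exact hcon ⟨j, rfl⟩
  obtain ⟨j₁, rfl⟩ := hnew d₁ hd₁ hfree₁
  obtain ⟨j₂, rfl⟩ := hnew d₂ hd₂ hfree₂
  have hj : j₁ ≠ j₂ := fun h => hne (by rw [h])
  let q : ZMod 4 → ZMod 4 → Fin r → G.edgeSet × ZMod 4 := fun δ₁ δ₂ j =>
    ((a j).1, ε * (a j).2 + c (a j).1 + (if j = j₁ then δ₁ else 0) + if j = j₂ then δ₂ else 0)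
  have hq : ∀ δ₁ δ₂, ((∑ x, p x - 2 * charge U v = 0 ∨ ∑ x, p x - 2 * charge U v = 1) ↔
      (∑ x, (ε * p x + c (e x)) - 2 * charge U' v + δ₁ + δ₂ = 0 ∨
        ∑ x, (ε * p x + c (e x)) - 2 * charge U' v + δ₁ + δ₂ = 1)) →
      IsCfiPosition G k U U' α' (Function.extend y (fun j => some (q δ₁ δ₂ j)) β) := by
    intro δ₁ δ₂ hδ
    refine isCfiPosition_of_full (by omega) hreg hext he hv (q := fun x => ε * p x + c (e x) +
      (if x = y j₁ then δ₁ else 0) + if x = y j₂ then δ₂ else 0) hα'e (fun x => ?_) ?_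
    · by_cases hx : ∃ j, y j = x
      · obtain ⟨j, rfl⟩ := hx
        have haj : a j = (e (y j), p (y j)) :=
          Option.some_injective _ ((hα'y j).symm.trans (hα'e _))
        rw [y.injective.extend_apply]
        simp only [q, haj, y.injective.eq_iff]
      · rw [Function.extend_apply' _ _ _ hx, hβ, ← hα'n x hx, hα'e,
          if_neg fun h => hx ⟨j₁, h.symm⟩, if_neg fun h => hx ⟨j₂, h.symm⟩]
        simp
    · have : ∑ x, (ε * p x + c (e x) + (if x = y j₁ then δ₁ else 0) +
          if x = y j₂ then δ₂ else 0) - 2 * charge U' v =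
          ∑ x, (ε * p x + c (e x)) - 2 * charge U' v + δ₁ + δ₂ := by
        rw [Finset.sum_add_distrib, Finset.sum_add_distrib, Finset.sum_ite_eq',
          Finset.sum_ite_eq', if_pos (Finset.mem_univ _), if_pos (Finset.mem_univ _)]
        ring
      rw [this]
      exact hδ
  obtain ⟨δ, hδ, hδδ⟩ := exists_class_shift (∑ x, p x - 2 * charge U v)
    (∑ x, (ε * p x + c (e x)) - 2 * charge U' v)
  -- Componentwise, `m` cancels the shifts: `m(δ, δ, 0) = 0` at `j₁` and `m(0, δ, δ) = 0` at `j₂`,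
  -- while the three tuples agree elsewhere.
  refine ⟨![q δ 0, q δ δ, q 0 δ], ?_, fun i => ?_⟩
  · refine MaltsevClosure.step (.base ⟨0, rfl⟩) (.base ⟨1, rfl⟩) (.base ⟨2, rfl⟩) fun j => ?_
    change IsMaltsev (q δ 0 j) (q δ δ j) (q 0 δ j) (f (a j))
    by_cases h₁ : j = j₁
    · subst h₁
      left
      simp [q, f, hj]
    · right
      simp [q, f, h₁]
  · fin_cases i
    · exact hq δ 0 (by simpa using hδ)
    · exact hq δ δ hδδ
    · exact hq 0 δ (by simpa using hδ)

/-- Duplicator has a uniform winning strategy on two structures over the same graph. -/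
theorem isUniformStrategy_cfi [Nonempty G.edgeSet] (hk : 3 ≤ k)
    (hreg : ∀ v, (edgesAt G v).card = k) (hext : HasExtensions G) :
    IsUniformStrategy (cfi G k U) (cfi G k U') (IsCfiPosition G k U U') := by
  intro α β h
  refine ⟨h.isPartialIso, h.uniformMove hk hreg hext, ?_⟩
  obtain ⟨f, hf⟩ := h.symm.uniformMove hk hreg hext
  refine ⟨f, fun r y a => ?_⟩
  obtain ⟨p, hp, hW⟩ := hf r y a
  exact ⟨p, hp, fun b hb => (hW b hb).symm⟩

end Game

/-! ### Non-isomorphism of the twisted and the untwisted structure -/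

theorem exists_strictMono_enumeration {E P : Type*} [LinearOrder P] {κ : E → P}
    (hκ : Function.Injective κ) {k : ℕ} {s : Finset E} (hs : s.card = k) :
    ∃ e : Fin k → E, StrictMono (fun i => κ (e i)) ∧ ∀ d, d ∈ s ↔ ∃ i, e i = d := by
  let _ : LinearOrder E := LinearOrder.lift' κ hκ
  refine ⟨s.orderEmbOfFin hs, fun i j hij => (s.orderEmbOfFin hs).strictMono hij, fun d => ?_⟩
  have := Set.ext_iff.1 (Finset.range_orderEmbOfFin s hs) d
  exact this.symm

theorem eq_id_of_preserves_order {E P : Type*} [Finite E] [LinearOrder P] {κ : E → P}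
    (hκ : Function.Injective κ) {g : E → E} (hg : ∀ d e, κ d ≤ κ e ↔ κ (g d) ≤ κ (g e)) (e : E) :
    g e = e := by
  let _ : LinearOrder E := LinearOrder.lift' κ hκ
  have hmono : StrictMono g := strictMono_of_le_iff_le hg
  exact le_antisymm hmono.apply_le hmono.le_apply

section Twist

variable {V : Type} [Fintype V] {G : SimpleGraph V} {k : ℕ}

/-- If every edge has exactly one endpoint in `L`, then summing over the edges at the vertices
in `L` amounts to summing over all edges. -/
theorem sum_vertexSum_eq [Fintype G.edgeSet] {M : Type*} [AddCommMonoid M] (L : Finset V)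
    (hL : ∀ e : G.edgeSet, ∃! v, v ∈ L ∧ v ∈ (e : Sym2 V)) (c : G.edgeSet → M) :
    ∑ v ∈ L, vertexSum c v = ∑ e, c e := by
  classical
  have h : ∀ v, vertexSum c v = ∑ e : G.edgeSet, if v ∈ (e : Sym2 V) then c e else 0 := fun v => by
    rw [← Finset.sum_filter, vertexSum]
    congr 1
    ext e
    simp
  simp only [h]
  rw [Finset.sum_comm]
  refine Finset.sum_congr rfl fun e _ => ?_
  obtain ⟨v, ⟨hv, hve⟩, huniq⟩ := hL e
  rw [Finset.sum_eq_single_of_mem v hv fun w hw hwv =>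
    if_neg fun hwe => hwv (huniq w ⟨hw, hwe⟩), if_pos hve]

set_option synthInstance.maxSize 1000 in
set_option synthInstance.maxHeartbeats 200000 in
-- Here `p` and `q` are the values at `0` and `1` of the permutations on two edges, with the rest of
-- the gadget sum absorbed into `q`. Among the sums `0 + 0`, `0 + 1`, `1 + 0`, `1 + 1` only the last
-- leaves `{0, 1}`, which makes both steps `1` or both `-1`.
theorem affine_of_class_iff : ∀ p₀ p₁ q₀ q₁ : ZMod 4,
    (p₀ + q₀ = 0 ∨ p₀ + q₀ = 1) → (p₀ + q₁ = 0 ∨ p₀ + q₁ = 1) → (p₁ + q₀ = 0 ∨ p₁ + q₀ = 1) →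
    ¬ (p₁ + q₁ = 0 ∨ p₁ + q₁ = 1) →
    (p₁ - p₀ = 1 ∧ q₁ - q₀ = 1 ∧ p₀ + q₀ = 0) ∨
      (p₁ - p₀ ≠ 1 ∧ q₁ - q₀ ≠ 1 ∧ p₀ + q₀ = 1) := by
  decide

/-- The permutations at the edges of a gadget that is preserved are all translations or all
reflections, and the sum of their values at `0` is determined by the charge `s` and by which of
the two cases occurs. -/
theorem exists_offset_of_preserves (hk : 2 ≤ k) {v : V} (hreg : (edgesAt G v).card = k)
    {π : G.edgeSet → ZMod 4 → ZMod 4} {s : ZMod 4}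
    (h : ∀ c : G.edgeSet → ZMod 4, (vertexSum c v = 0 ∨ vertexSum c v = 1) ↔
      (vertexSum (fun e => π e (c e)) v - 2 * s = 0 ∨
        vertexSum (fun e => π e (c e)) v - 2 * s = 1)) :
    ∃ r : ℕ, vertexSum (fun e => π e 0) v = 2 * s + r ∧
      vertexSum (fun e => if π e 1 - π e 0 = 1 then 0 else 1) v = k * r := by
  classical
  have key : ∀ d ∈ edgesAt G v, ∀ d' ∈ edgesAt G v, d ≠ d' →
      π d 1 - π d 0 = 1 ∧ π d' 1 - π d' 0 = 1 ∧ vertexSum (fun e => π e 0) v = 2 * s ∨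
      π d 1 - π d 0 ≠ 1 ∧ π d' 1 - π d' 0 ≠ 1 ∧ vertexSum (fun e => π e 0) v = 2 * s + 1 := by
    intro d hd d' hd' hne
    have hd'' : d' ∈ (edgesAt G v).erase d := Finset.mem_erase.2 ⟨hne.symm, hd'⟩
    have hsplit : ∀ c : G.edgeSet → ZMod 4, vertexSum c v =
        c d + c d' + ∑ e ∈ ((edgesAt G v).erase d).erase d', c e := fun c => by
      rw [vertexSum, ← Finset.add_sum_erase _ _ hd, ← Finset.add_sum_erase _ _ hd'', add_assoc]
    set K := ∑ e ∈ ((edgesAt G v).erase d).erase d', π e 0 with hK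
    have hab : ∀ a b, (a + b = 0 ∨ a + b = 1) ↔ (π d a + (π d' b + K - 2 * s) = 0 ∨
        π d a + (π d' b + K - 2 * s) = 1) := by
      intro a b
      -- Test labelling: `a` on `d`, `b` on `d'` and `0` on all other edges.
      have h₁ := h fun e => if e = d then a else if e = d' then b else 0
      have h₂ : ∀ e ∈ ((edgesAt G v).erase d).erase d', e ≠ d ∧ e ≠ d' := fun e he => by
        simp only [Finset.mem_erase] at he
        exact ⟨he.2.1, he.1⟩
      rw [hsplit, hsplit, Finset.sum_eq_zero fun e he => by
          rw [if_neg (h₂ e he).1, if_neg (h₂ e he).2],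
        Finset.sum_congr rfl fun e he => by
          rw [if_neg (h₂ e he).1, if_neg (h₂ e he).2], ← hK] at h₁
      simp only [if_true, if_neg hne.symm, add_zero] at h₁
      rw [h₁, show π d a + (π d' b + K - 2 * s) = π d a + π d' b + K - 2 * s by ring]
    have h₀ : vertexSum (fun e => π e 0) v = 2 * s + (π d 0 + (π d' 0 + K - 2 * s)) := by
      rw [hsplit]
      ring
    have h₁ : ∀ x : ZMod 4, π d' 1 - π d' 0 = x ↔
        (π d' 1 + K - 2 * s) - (π d' 0 + K - 2 * s) = x := fun x => by
      rw [show (π d' 1 + K - 2 * s) - (π d' 0 + K - 2 * s) = π d' 1 - π d' 0 by ring]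
    rw [h₀, Ne.eq_def (π d' 1 - _), h₁]
    rcases affine_of_class_iff _ _ _ _ ((hab 0 0).1 (by decide)) ((hab 0 1).1 (by decide))
      ((hab 1 0).1 (by decide)) (mt (hab 1 1).2 (by decide)) with h | h
    · exact .inl ⟨h.1, h.2.1, by rw [h.2.2, add_zero]⟩
    · exact .inr ⟨h.1, h.2.1, by rw [h.2.2]⟩
  obtain ⟨d, hd, d', hd', hne⟩ := Finset.one_lt_card.1 (hk.trans_eq hreg.symm)
  have hall : ∀ e ∈ edgesAt G v, (π e 1 - π e 0 = 1 ↔ π d 1 - π d 0 = 1) := by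
    intro e he
    by_cases hed : e = d
    · rw [hed]
    · rcases key e he d hd hed with h | h <;> simp [h.1, h.2.1]
  have hsum : vertexSum (fun e => if π e 1 - π e 0 = 1 then 0 else 1) v =
      k * if π d 1 - π d 0 = 1 then 0 else 1 := by
    rw [vertexSum_congr (d := fun _ => if π d 1 - π d 0 = 1 then 0 else 1)
      fun e he => by simp only [hall e he]]
    simp [vertexSum, hreg]
  refine ⟨_, ?_, hsum⟩
  rcases key d hd d' hd' hne with h | h
  · simp [h.1, h.2.2]
  · simp [h.1, h.2.2]

variable [LinearOrder V]

/-- Pairs over the same edge are related by `≺` in both directions, so the map induces a map on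
edges; an order-preserving self-map of a finite linear order is the identity. -/
theorem fst_eq_of_preserves_order {f : G.edgeSet × ZMod 4 → G.edgeSet × ZMod 4}
    (hf : ∀ p q, edgeKey p.1 ≤ edgeKey q.1 ↔ edgeKey (f p).1 ≤ edgeKey (f q).1)
    (p : G.edgeSet × ZMod 4) : (f p).1 = p.1 := by
  have h₁ : (f (p.1, 0)).1 = p.1 :=
    eq_id_of_preserves_order edgeKey_injective (g := fun e => (f (e, 0)).1)
      (fun d e => hf (d, 0) (e, 0)) p.1
  have h₂ : (f p).1 = (f (p.1, 0)).1 :=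
    edgeKey_injective (le_antisymm ((hf p (p.1, 0)).1 le_rfl) ((hf (p.1, 0) p).1 le_rfl))
  rw [h₂, h₁]

theorem mem_cfiRel_zero_iff (hk : 2 ≤ k) (hreg : ∀ v, (edgesAt G v).card = k) {U : Set V} {v : V}
    {e : Fin k → G.edgeSet} (he : StrictMono fun i => edgeKey (e i))
    (hv : ∀ d, d ∈ edgesAt G v ↔ ∃ i, e i = d) (c : G.edgeSet → ZMod 4) :
    (fun i => (e i, c (e i))) ∈ cfiRel G k U 0 ↔
      vertexSum c v - 2 * charge U v = 0 ∨ vertexSum c v - 2 * charge U v = 1 := by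
  have hinj : Function.Injective e := fun i j h => he.injective (congrArg edgeKey h)
  rw [mem_cfiRel, ← sum_eq_vertexSum hinj hv]
  constructor
  · rintro ⟨u, -, h₂, h₃⟩
    obtain rfl : u = v := edgesAt_injective hk hreg fun d hd => by
      rw [← mem_edgesAt, hv, ← exists_of_range_eq h₂ d]
      exact mem_edgesAt.2 hd
    exact h₃
  · exact fun h => ⟨v, he, range_eq_of_forall hv, h⟩

/-- Over a regular bipartite graph the twisted structure is not isomorphic to the untwisted one. -/
theorem not_isomorphic_cfi [Nonempty G.edgeSet] (hk : 2 ≤ k) (hreg : ∀ v, (edgesAt G v).card = k)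
    (L : Finset V) (hL : ∀ u v, G.Adj u v → (u ∈ L ↔ v ∉ L)) (v₀ : V) :
    ¬ (cfi G k ∅).Isomorphic (cfi G k {v₀}) := by
  classical
  rintro ⟨f, hf⟩
  have := Fintype.ofFinite G.edgeSet
  let g : G.edgeSet × ZMod 4 → G.edgeSet × ZMod 4 := f
  have hg₀ : ∀ t : Fin k → G.edgeSet × ZMod 4,
      t ∈ cfiRel G k ∅ 0 ↔ (fun i => g (t i)) ∈ cfiRel G k {v₀} 0 := hf (0 : Fin 3)
  have hg₂ : ∀ p q : G.edgeSet × ZMod 4,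
      edgeKey p.1 ≤ edgeKey q.1 ↔ edgeKey (g p).1 ≤ edgeKey (g q).1 :=
    fun p q => hf (2 : Fin 3) ![p, q]
  have hg : ∀ e a, g (e, a) = (e, (g (e, a)).2) := fun e a =>
    Prod.ext (fst_eq_of_preserves_order hg₂ (e, a)) rfl
  have hr : ∀ v, ∃ r : ℕ, vertexSum (fun e => (g (e, 0)).2) v = 2 * charge {v₀} v + r ∧
      vertexSum (fun e => if (g (e, 1)).2 - (g (e, 0)).2 = 1 then 0 else 1) v = k * r := by
    intro v
    refine exists_offset_of_preserves (π := fun e a => (g (e, a)).2) hk (hreg v) fun c => ?_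
    obtain ⟨e, he, hv⟩ := exists_strictMono_enumeration edgeKey_injective (hreg v)
    rw [← mem_cfiRel_zero_iff hk hreg he hv fun e => (g (e, c e)).2]
    have h := mem_cfiRel_zero_iff (U := ∅) hk hreg he hv c
    rw [hg₀, charge, Set.indicator_empty, mul_zero, sub_zero] at h
    rw [← h]
    exact Iff.of_eq (congrArg (· ∈ cfiRel G k {v₀} 0) (funext fun i => hg (e i) (c (e i))))
  choose r hr₀ hr₁ using hr
  have hside : ∀ S : Finset V, (∀ u v, G.Adj u v → (u ∈ S ↔ v ∉ S)) → ∀ e : G.edgeSet,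
      ∃! v, v ∈ S ∧ v ∈ (e : Sym2 V) := by
    rintro S hS ⟨e, he⟩
    induction e with
    | h u w =>
      have := hS u w he
      simp only [Sym2.mem_iff]
      by_cases hu : u ∈ S
      · exact ⟨u, ⟨hu, .inl rfl⟩, by grind⟩
      · exact ⟨w, ⟨by tauto, .inr rfl⟩, by grind⟩
  have hL' : ∀ u v, G.Adj u v → (u ∈ Lᶜ ↔ v ∉ Lᶜ) := fun u v h => by
    rw [Finset.mem_compl, Finset.mem_compl, hL u v h]
  -- Both sides count the edges with a reflection. The count is made in `ℕ`, where `k` can be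
  -- cancelled even if it is not invertible modulo `4`.
  have h₁ : ∑ v ∈ L, k * r v = ∑ v ∈ Lᶜ, k * r v := by
    simp only [← hr₁]
    rw [sum_vertexSum_eq _ (hside L hL), sum_vertexSum_eq _ (hside _ hL')]
  -- Both sides are the sum over all edges of the image of `0`. Once the `r v` cancel, exactly one
  -- side retains `2 ≠ 0`, contributed by `v₀`.
  have h₂ : ∑ v ∈ L, (2 * charge {v₀} v + (r v : ZMod 4)) =
      ∑ v ∈ Lᶜ, (2 * charge {v₀} v + (r v : ZMod 4)) := by
    simp only [← hr₀]
    rw [sum_vertexSum_eq _ (hside L hL), sum_vertexSum_eq _ (hside _ hL')]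
  rw [← Finset.mul_sum, ← Finset.mul_sum] at h₁
  have h₃ := congrArg (Nat.cast : ℕ → ZMod 4) (Nat.eq_of_mul_eq_mul_left (by omega) h₁)
  push_cast at h₃
  rw [Finset.sum_add_distrib, Finset.sum_add_distrib, h₃, add_left_inj, ← Finset.mul_sum,
    ← Finset.mul_sum] at h₂
  simp only [charge, Set.indicator_apply, Set.mem_singleton_iff, Pi.one_apply,
    Finset.sum_ite_eq', Finset.mem_compl] at h₂
  by_cases hv : v₀ ∈ L <;> simp only [hv, not_true_eq_false, not_false_eq_true, if_true, if_false]
    at h₂ <;> revert h₂ <;> decide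

end Twist

/-! ### Edge labellings with prescribed sums -/

section Extension

variable {V : Type} [Fintype V] {G : SimpleGraph V}

/-- Extensions exist if the graph remains connected when `v` is removed. -/
theorem hasExtensions_of_connected
    (h : ∀ v : V, ∃ w ≠ v, ∀ S : Set V, w ∈ S →
      (∀ u ∈ S, ∀ z, G.Adj u z → u ≠ v → z ≠ v → z ∈ S) → ∀ u ≠ v, u ∈ S) :
    HasExtensions G := by
  classical
  intro v
  obtain ⟨w, hwv, hw⟩ := h v
  -- A unit of sum is carried from `w` to `u` along a path avoiding `v`, with alternating signs on
  -- its edges; the surplus at `w` is unconstrained.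
  have key : ∀ u ≠ v, ∃ g : G.edgeSet → ZMod 4, (∀ e ∈ edgesAt G v, g e = 0) ∧
      ∀ z ≠ w, vertexSum g z = if z = u then 1 else 0 := by
    refine hw {u | ∃ g : G.edgeSet → ZMod 4, (∀ e ∈ edgesAt G v, g e = 0) ∧
      ∀ z ≠ w, vertexSum g z = if z = u then 1 else 0} ?_ ?_
    · exact ⟨fun _ => 0, fun _ _ => rfl, fun z hz => by rw [vertexSum_zero, if_neg hz]⟩
    · rintro u ⟨g, hg, hgu⟩ z huz huv hzv
      let e : G.edgeSet := ⟨s(u, z), huz⟩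
      refine ⟨fun d => (Pi.single e 1 : G.edgeSet → ZMod 4) d - g d, fun d hd => ?_,
        fun x hx => ?_⟩
      · have : d ≠ e := by
          rintro rfl
          simp [e, huv.symm, hzv.symm] at hd
        simp [this, hg d hd]
      · have huz' : u ≠ z := huz.ne
        rw [vertexSum_sub, vertexSum_single, hgu x hx]
        simp only [e, Sym2.mem_iff]
        grind
  choose! g hg hgs using key
  refine ⟨w, hwv, fun c s => ?_⟩
  -- The unit labellings correct the defect of `c` at each vertex separately.
  refine ⟨fun e => c e + ∑ u with u ≠ v, (s u - vertexSum c u) * g u e, fun e he => ?_,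
    fun z hzw hzv => ?_⟩
  · refine add_eq_left.2 (Finset.sum_eq_zero fun u hu => ?_)
    rw [hg u (Finset.mem_filter.1 hu).2 e he, mul_zero]
  · rw [vertexSum_add, vertexSum_finset_sum]
    simp only [vertexSum_mul]
    rw [Finset.sum_eq_single_of_mem z (by simp [hzv]) fun u hu huz => by
      rw [hgs u (Finset.mem_filter.1 hu).2 z hzw, if_neg huz.symm, mul_zero],
      hgs z hzv z hzw, if_pos rfl]
    ring

end Extension

/-! ### The complete bipartite graph without a perfect matching -/

section Biclique

theorem bicliqueMinusMatching_adj_inl_inr {n : ℕ} {i j : Fin n} :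
    (bicliqueMinusMatching n).Adj (.inl i) (.inr j) ↔ i ≠ j := by
  simp [bicliqueMinusMatching]

theorem bicliqueMinusMatching_adj_inr_inl {n : ℕ} {i j : Fin n} :
    (bicliqueMinusMatching n).Adj (.inr i) (.inl j) ↔ i ≠ j := by
  rw [SimpleGraph.adj_comm, bicliqueMinusMatching_adj_inl_inr, ne_comm]

theorem bicliqueMinusMatching_adj_inl_inl {n : ℕ} {i j : Fin n} :
    ¬ (bicliqueMinusMatching n).Adj (.inl i) (.inl j) := by
  simp [bicliqueMinusMatching]

theorem bicliqueMinusMatching_adj_inr_inr {n : ℕ} {i j : Fin n} :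
    ¬ (bicliqueMinusMatching n).Adj (.inr i) (.inr j) := by
  simp [bicliqueMinusMatching]

/-- Take for `w` the partner of `v` in the removed matching: it is adjacent to every other vertex on
the side of `v`. The vertices on its own side are then reached through a third index, which needs `n
≥ 3`. -/
theorem bicliqueMinusMatching_connected_remove {n : ℕ} (hn : 3 ≤ n) (v : Fin n ⊕ Fin n) :
    ∃ w ≠ v, ∀ S : Set (Fin n ⊕ Fin n), w ∈ S →
      (∀ u ∈ S, ∀ z, (bicliqueMinusMatching n).Adj u z → u ≠ v → z ≠ v → z ∈ S) →
      ∀ u ≠ v, u ∈ S := by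
  have hthird : ∀ i j : Fin n, ∃ m, m ≠ i ∧ m ≠ j := fun i j => by
    have : ({i, j} : Finset (Fin n)).card < (Finset.univ : Finset (Fin n)).card :=
      Finset.card_le_two.trans_lt (by simpa using Nat.lt_of_succ_le hn)
    obtain ⟨m, -, hm⟩ := Finset.exists_mem_notMem_of_card_lt_card this
    exact ⟨m, by simpa using hm⟩
  rcases v with i | i
  · refine ⟨.inr i, by simp, fun S hi hS => ?_⟩
    have h₁ : ∀ j ≠ i, .inl j ∈ S := fun j hj =>
      hS _ hi _ (bicliqueMinusMatching_adj_inr_inl.2 hj.symm) (by simp) (by simpa)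
    rintro (j | j) hj
    · exact h₁ j (by simpa using hj)
    · obtain ⟨m, hmi, hmj⟩ := hthird i j
      exact hS _ (h₁ m hmi) _ (bicliqueMinusMatching_adj_inl_inr.2 hmj) (by simpa) (by simp)
  · refine ⟨.inl i, by simp, fun S hi hS => ?_⟩
    have h₁ : ∀ j ≠ i, .inr j ∈ S := fun j hj =>
      hS _ hi _ (bicliqueMinusMatching_adj_inl_inr.2 hj.symm) (by simp) (by simpa)
    rintro (j | j) hj
    · obtain ⟨m, hmi, hmj⟩ := hthird i j
      exact hS _ (h₁ m hmi) _ (bicliqueMinusMatching_adj_inr_inl.2 hmj) (by simpa) (by simp)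
    · exact h₁ j (by simpa using hj)

theorem bicliqueMinusMatching_ncard_neighborSet {n : ℕ} (v : Fin (n + 1) ⊕ Fin (n + 1)) :
    ((bicliqueMinusMatching (n + 1)).neighborSet v).ncard = n := by
  have hcard : ∀ i : Fin (n + 1), ({i}ᶜ : Set (Fin (n + 1))).ncard = n := fun i => by
    rw [Set.ncard_compl, Set.ncard_singleton, Nat.card_fin, Nat.add_sub_cancel]
  rcases v with i | i
  · rw [show (bicliqueMinusMatching (n + 1)).neighborSet (.inl i) = Sum.inr '' {i}ᶜ by
      ext (j | j)
      · simp [bicliqueMinusMatching_adj_inl_inl]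
      · simp [bicliqueMinusMatching_adj_inl_inr, eq_comm],
      Set.ncard_image_of_injective _ Sum.inr_injective, hcard]
  · rw [show (bicliqueMinusMatching (n + 1)).neighborSet (.inr i) = Sum.inl '' {i}ᶜ by
      ext (j | j)
      · simp [bicliqueMinusMatching_adj_inr_inl, eq_comm]
      · simp [bicliqueMinusMatching_adj_inr_inr],
      Set.ncard_image_of_injective _ Sum.inl_injective, hcard]

variable {V : Type} [Fintype V] {G : SimpleGraph V}

theorem card_edgesAt (v : V) : (edgesAt G v).card = (G.neighborSet v).ncard := by
  classical
  have h₁ : (G.incidenceSet v).ncard = (G.neighborSet v).ncard :=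
    Nat.card_congr (G.incidenceSetEquivNeighborSet v)
  rw [← h₁, ← Set.ncard_coe_finset, ← Set.ncard_image_of_injective _ Subtype.val_injective]
  congr 1
  ext e
  simp [SimpleGraph.incidenceSet, and_comm]

theorem card_edgesAt_of_iso {n : ℕ} (φ : G ≃g bicliqueMinusMatching (n + 1)) (v : V) :
    (edgesAt G v).card = n := by
  rw [card_edgesAt, ← bicliqueMinusMatching_ncard_neighborSet (φ v)]
  exact Nat.card_congr (φ.mapNeighborSet v)

theorem hasExtensions_of_iso {n : ℕ} (hn : 3 ≤ n) (φ : G ≃g bicliqueMinusMatching n) :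
    HasExtensions G := by
  refine hasExtensions_of_connected fun v => ?_
  obtain ⟨w, hw, h⟩ := bicliqueMinusMatching_connected_remove hn (φ v)
  refine ⟨φ.symm w, fun hwv => hw (by rw [← hwv, φ.apply_symm_apply]), fun S hwS hS u huv => ?_⟩
  have := h (φ.symm ⁻¹' S) hwS (fun u hu z huz huv hzv =>
    hS _ hu _ (φ.symm.map_adj_iff.2 huz) (fun h => huv (by rw [← h, φ.apply_symm_apply]))
      (fun h => hzv (by rw [← h, φ.apply_symm_apply]))) (φ u) (φ.injective.ne huv)
  rwa [Set.mem_preimage, φ.symm_apply_apply] at this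

omit [Fintype V] in
theorem isLeft_iff_of_iso {n : ℕ} (φ : G ≃g bicliqueMinusMatching n) (u v : V) (h : G.Adj u v) :
    u ∈ {v | (φ v).isLeft} ↔ v ∉ {v | (φ v).isLeft} := by
  have h' := φ.map_adj_iff.2 h
  change (φ u).isLeft = true ↔ ¬ (φ v).isLeft = true
  rcases hu : φ u with i | i <;> rcases hv : φ v with j | j <;> rw [hu, hv] at h'
  · exact (bicliqueMinusMatching_adj_inl_inl h').elim
  · simp
  · simp
  · exact (bicliqueMinusMatching_adj_inr_inr h').elim

end Biclique

/-! ### The separation of the two logics -/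

theorem exists_eq_cfiTwisted {V : Type} [Fintype V] [LinearOrder V] (G : SimpleGraph V)
    [Nonempty G.edgeSet] (k : ℕ) : ∃ v, cfiTwisted G k = cfi G k {v} := by
  obtain ⟨e⟩ := ‹Nonempty G.edgeSet›
  have : Nonempty V := ⟨(e : Sym2 V).inf⟩
  obtain ⟨v, hv⟩ := Finite.exists_min (id : V → V)
  refine ⟨v, congrArg (cfi G k) (Set.ext fun w => ⟨fun hw => ?_, fun hw => ?_⟩)⟩
  · exact le_antisymm (hw v) (hv w)
  · rw [Set.mem_singleton_iff.1 hw]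
    exact hv

/-- The statement about the structures over a bipartite graph without its perfect matching. -/
theorem cfi_separation {k : ℕ} (hk : 3 ≤ k) {V : Type} [Fintype V] [LinearOrder V]
    (G : SimpleGraph V) [Nonempty G.edgeSet] (φ : G ≃g bicliqueMinusMatching (k + 1)) :
    ¬ (cfiUntwisted G k).Isomorphic (cfiTwisted G k) ∧
    (∃ φ : Sentence (cfiVocabulary k) k (quantifiersOfArity k),
      (cfiUntwisted G k).Models φ ∧ ¬ (cfiTwisted G k).Models φ) ∧
    (∀ φ : Sentence (cfiVocabulary k) k (maltsevQuantifiersOfArity k),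
      (cfiUntwisted G k).Models φ ↔ (cfiTwisted G k).Models φ) ∧
    DuplicatorWins k (cfiUntwisted G k) (cfiTwisted G k) (fun _ => none) (fun _ => none) := by
  classical
  obtain ⟨v, hv⟩ := exists_eq_cfiTwisted G k
  have hreg := card_edgesAt_of_iso φ
  have hiso : ¬ (cfiUntwisted G k).Isomorphic (cfiTwisted G k) := by
    rw [hv]
    refine not_isomorphic_cfi (by omega) hreg (Finset.univ.filter fun v => (φ v).isLeft)
      (fun u w h => ?_) v
    simpa using isLeft_iff_of_iso φ u w h
  have hW := isUniformStrategy_cfi (U := ∅) (U' := {v}) hk hreg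
    (hasExtensions_of_iso (by omega) φ)
  have hW₀ := isCfiPosition_empty hreg (by omega) v
  have har : ∀ i, (cfiVocabulary k).ar i ≤ k := by
    intro i
    match i with
    | 0 => exact le_rfl
    | 1 => exact le_rfl
    | 2 => exact (by omega : 2 ≤ k)
  refine ⟨hiso, ⟨isoTypeSentence (cfiUntwisted G k) har, ?_, ?_⟩, fun ψ => ?_, ?_⟩
  · exact (models_isoTypeSentence _ _ har).2 (.refl _)
  · rwa [models_isoTypeSentence]
  · rw [hv]
    exact hW.models_iff hW₀ ψ
  · rw [hv]
    exact hW.duplicatorWins hW₀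

theorem mainTheorem4 (k : ℕ) (hk : 3 ≤ k) :
    LogicLT k (maltsevQuantifiersOfArity k) (quantifiersOfArity k) ∧
    ∀ (V : Type) [Fintype V] [LinearOrder V] (G : SimpleGraph V) [Nonempty G.edgeSet],
      Nonempty (G ≃g bicliqueMinusMatching (k + 1)) →
        ¬ (cfiUntwisted G k).Isomorphic (cfiTwisted G k) ∧
        (∃ φ : Sentence (cfiVocabulary k) k (quantifiersOfArity k),
          (cfiUntwisted G k).Models φ ∧ ¬ (cfiTwisted G k).Models φ) ∧
        (∀ φ : Sentence (cfiVocabulary k) k (maltsevQuantifiersOfArity k),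
          (cfiUntwisted G k).Models φ ↔ (cfiTwisted G k).Models φ) ∧
        DuplicatorWins k (cfiUntwisted G k) (cfiTwisted G k) (fun _ => none) (fun _ => none) := by
  refine ⟨⟨logicLE_of_subset k Set.inter_subset_right, fun hle => ?_⟩,
    fun V _ _ G _ ⟨φ⟩ => cfi_separation hk G φ⟩
  let _ : LinearOrder (Fin (k + 1) ⊕ Fin (k + 1)) := LinearOrder.lift' toLex toLex.injective
  have : Nonempty (bicliqueMinusMatching (k + 1)).edgeSet :=
    ⟨s(.inl 0, .inr (Fin.last k)), bicliqueMinusMatching_adj_inl_inr.2 fun h => by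
      have := congrArg Fin.val h
      simp only [Fin.val_zero, Fin.val_last] at this
      omega⟩
  obtain ⟨-, ⟨φ, hφ, hφ'⟩, heq, -⟩ :=
    cfi_separation hk (bicliqueMinusMatching (k + 1)) SimpleGraph.Iso.refl
  obtain ⟨ψ, hψ⟩ := hle _ φ
  exact hφ' ((hψ _).2 ((heq ψ).1 ((hψ _).1 hφ)))
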